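/- Let $g:\mathbb{N}\to[0,\infty)$ be a non-negative multiplicative arithmetic function (that is, $g(1)=1$ and $g(mn)=g(m)g(n)$ whenever $\gcd(m,n)=1$) that is uniformly bounded on the primes: there is a constant $\beta$ with $g(p)\le\beta$ for every prime $p$. Assume that there is a constant $c>0$ such that for each $b$ with $0<b<1$, \[ \liminf_{x\to\infty}\ \frac{1}{(1-b)\log x}\sum_{x^b<p\le x}\frac{g(p)\log p}{p}\ \ge\ c, \] where $x$ runs through the real numbers and $p$ through the primes. Then there is a constant $c_0>0$ such that for all real $x\ge 2$, \[ \sum_{n\le x} g(n)\ \ge\ \frac{c_0\,x}{\log x}\prod_{p\le x}\left(1+\frac{g(p)}{p}\right), \] where the sum is over the positive integers $n\le x$ and the product over the primes $p\le x$. -/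

import Mathlib

/-!
The right-hand side only sees the prime values of `g`, so it is enough to find sufficiently many
integers of the shape `n = m * p₁ ⋯ p_r`, where `m` is squarefree and composed of primes at most
`x ^ η`, `m ≤ √x`, and the `pᵢ` are distinct primes larger than `x ^ η`. Here `r` and `η` are
constants. An integer has boundedly many such decompositions, because it has at most `1 / η` prime
factors above `x ^ η` (`sum_sum_prod_le`).

* The `m`-part: by Markov's inequality for `log m`, for small `η` the sum of `g m / m` over
  `m ≤ √x` is at least half of the Euler product up to `x ^ η` (`half_prod_one_add_le`), which is
  comparable to the Euler product up to `x` (`prod_one_add_le_exp_mul`).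
* The prime part: for `X = x / m`, the products `p₁ ⋯ p_r ≤ X` have total `g`-weight at least a
  constant times `X / log X` (`exists_sum_prod_large_primes_ge`). This is the core of the proof.

For the prime part, cut the primes into the cells `exp (j - 1) < p ≤ exp j`. The hypothesis, used
only with exponent `b = 1 / 2`, and Chebyshev's bound show that the set `A` of the cells `j` on
which `g` has mass `≫ exp j / j` satisfies `#(A ∩ (h, 2 h]) ≥ d h` for all large `h`
(`exists_card_filter_primeCell_ge`). Nothing is known about `A` at finer scales: it may have long
gaps, or live in a residue class, so a single prime factor is not enough. But the sums of a bounded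
number `2 k` of elements of `A` hit every integer `N`, up to a bounded error, with the expected
order `h ^ (2 k - 1)` of representations, where `h ≍ N` (`exists_card_sums_ge`). Since a
representation `∑ jᵢ = N + O(1)` contributes a weight `≫ ∏ (exp jᵢ / jᵢ) ≍ exp N / h ^ (2 k)`, the
total is `≫ exp N / N`.

The statement about sums is proved modulo a popular difference `D ≍ h` of `A`. By Pollard's theorem
(`ZMod.pollard`), a refinement of Cauchy–Davenport, a set of positive density in `ZMod p` is a basis
of bounded order with many representations of every residue (`ZMod.exists_sumReps_ge`); rounding
transfers this from a prime `p ≍ D` to the modulus `D`. Thus `k` elements of `A` bring the sum to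
the right class modulo `D` up to `O(1)`, and `k` further elements `e` with `e, e + D ∈ A` allow the
remaining multiple of `D` to be corrected.
-/

open Finset

/-! ### Pollard's theorem -/

/-- The number of representations `x = a + b` with `a ∈ A` and `b ∈ B`. -/
def repCount {G : Type*} [AddCommGroup G] [DecidableEq G] (A B : Finset G) (x : G) : ℕ :=
  ∑ a ∈ A, ∑ b ∈ B, if a + b = x then 1 else 0

section RepCount

variable {G : Type*} [AddCommGroup G] [DecidableEq G]

lemma repCount_eq_card_filter (A B : Finset G) (x : G) :
    repCount A B x = #{a ∈ A | x - a ∈ B} := by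
  rw [repCount, card_filter]
  refine sum_congr rfl fun a _ ↦ ?_
  have h : ∀ b, (a + b = x) ↔ (b = x - a) := fun b ↦ by
    rw [eq_sub_iff_add_eq, add_comm]
  simp [h]

lemma repCount_comm (A B : Finset G) (x : G) : repCount A B x = repCount B A x := by
  rw [repCount, repCount, sum_comm]
  simp only [add_comm]

lemma repCount_union_left {A A' : Finset G} (h : Disjoint A A') (B : Finset G) (x : G) :
    repCount (A ∪ A') B x = repCount A B x + repCount A' B x :=
  sum_union h

lemma repCount_le_left (A B : Finset G) (x : G) : repCount A B x ≤ #A := by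
  rw [repCount_eq_card_filter]
  exact card_filter_le _ _

lemma sum_repCount [Fintype G] (A B : Finset G) : ∑ x, repCount A B x = #A * #B := by
  simp only [repCount]
  rw [sum_comm]
  simp_rw [sum_comm (s := univ), sum_ite_eq]
  simp

lemma repCount_map_add_right (A B : Finset G) (z x : G) :
    repCount A (B.map (addRightEmbedding z)) x = repCount A B (x - z) := by
  simp only [repCount, sum_map, addRightEmbedding_apply]
  simp only [eq_sub_iff_add_eq, add_assoc]

/-- Dyson's transform preserves the number of representations, up to those between the
set differences. -/
lemma repCount_eq_union_inter_add (A B : Finset G) (x : G) :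
    repCount A B x =
      repCount (A ∪ B) (A ∩ B) x + repCount (A \ (A ∩ B)) (B \ (A ∩ B)) x := by
  have h1 : repCount A B x =
      repCount A (A ∩ B) x + repCount A (B \ (A ∩ B)) x := by
    rw [repCount_comm A B, repCount_comm A, repCount_comm A,
      ← repCount_union_left disjoint_sdiff, union_sdiff_of_subset inter_subset_right]
  have h2 : repCount A (B \ (A ∩ B)) x = repCount (A ∩ B) (B \ (A ∩ B)) x +
      repCount (A \ (A ∩ B)) (B \ (A ∩ B)) x := by
    rw [← repCount_union_left disjoint_sdiff, union_sdiff_of_subset inter_subset_left]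
  have h3 : repCount (A ∪ B) (A ∩ B) x =
      repCount A (A ∩ B) x + repCount (B \ (A ∩ B)) (A ∩ B) x := by
    rw [← repCount_union_left]
    · congr 1
      ext y; simp
    · rw [disjoint_left]; intro y; simp; tauto
  rw [h1, h2, h3, repCount_comm (B \ (A ∩ B))]
  ring

end RepCount

lemma ZMod.exists_mem_add_notMem {p : ℕ} [Fact p.Prime] {A : Finset (ZMod p)}
    (hA : A.Nonempty) (hA' : A ≠ univ) {q : ZMod p} (hq : q ≠ 0) : ∃ a ∈ A, a + q ∉ A := by
  by_contra! h
  obtain ⟨a, ha⟩ := hA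
  refine hA' (eq_univ_iff_forall.2 fun x ↦ ?_)
  have key : ∀ n : ℕ, a + n * q ∈ A := by
    intro n
    induction n with
    | zero => simpa
    | succ n ih => have := h _ ih; push_cast; rwa [add_mul, one_mul, ← add_assoc]
  have := key ((x - a) / q).val
  rw [ZMod.natCast_zmod_val, div_mul_cancel₀ _ hq] at this
  simpa using this

/-- **Pollard's theorem**, the strengthening of the Cauchy–Davenport theorem that counts
representations with multiplicity truncated at `t`. -/
theorem ZMod.pollard {p : ℕ} [Fact p.Prime] (A B : Finset (ZMod p)) (t : ℕ)
    (hA : t ≤ #A) (hB : t ≤ #B) :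
    t * min p (#A + #B - t) ≤ ∑ x, min t (repCount A B x) := by
  induction hn : #B using Nat.strong_induction_on generalizing A B t with
  | _ n ih =>
  subst hn
  rcases Nat.eq_zero_or_pos t with rfl | ht
  · simp
  rcases hB.eq_or_lt with hBt | hBt
  · have : ∀ x, min t (repCount A B x) = repCount A B x := fun x ↦ by
      rw [min_eq_right]; rw [repCount_comm, hBt]; exact repCount_le_left _ _ _
    rw [sum_congr rfl fun x _ ↦ this x, sum_repCount, ← hBt, mul_comm]
    gcongr
    omega
  by_cases hAu : A = univ
  · have : ∀ x, min t (repCount A B x) = t := fun x ↦ by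
      rw [min_eq_left]
      rw [repCount_comm, repCount_eq_card_filter, hAu]
      simpa using hB
    rw [sum_congr rfl fun x _ ↦ this x]
    simp only [sum_const, card_univ, ZMod.card, smul_eq_mul]
    rw [mul_comm p]
    gcongr
    exact min_le_left _ _
  obtain ⟨b₁, hb₁, b₂, hb₂, hb⟩ := one_lt_card.1 (lt_of_le_of_lt ht hBt)
  obtain ⟨a, ha, haq⟩ := ZMod.exists_mem_add_notMem (card_pos.1 (ht.trans_le hA)) hAu
    (sub_ne_zero.2 hb.symm)
  -- Translate `B` so that it meets `A` without being contained in it.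
  obtain ⟨C, hC⟩ : ∃ C, C = B.map (addRightEmbedding (a - b₁)) := ⟨_, rfl⟩
  have hCB : #C = #B := by rw [hC, card_map]
  have hsum : ∑ x, min t (repCount A B x) = ∑ x, min t (repCount A C x) := by
    simp only [hC, repCount_map_add_right]
    exact (Equiv.sum_comp (Equiv.subRight (a - b₁)) fun x ↦ min t (repCount A B x)).symm
  have haC : a ∈ A ∩ C := by
    rw [mem_inter, hC, mem_map]
    exact ⟨ha, b₁, hb₁, by simp⟩
  have hIpos : 0 < #(A ∩ C) := card_pos.2 ⟨a, haC⟩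
  have hIlt : #(A ∩ C) < #C := by
    refine card_lt_card ⟨inter_subset_right, fun h ↦ haq ?_⟩
    have : a + (b₂ - b₁) ∈ C := by
      rw [hC, mem_map]; exact ⟨b₂, hb₂, by simp [addRightEmbedding]; ring⟩
    exact (mem_inter.1 (h this)).1
  have hUI := card_union_add_card_inter A C
  have hAU : #A ≤ #(A ∪ C) := card_le_card subset_union_left
  have hA' : #(A \ (A ∩ C)) = #A - #(A ∩ C) := card_sdiff_of_subset inter_subset_left
  have hC' : #(C \ (A ∩ C)) = #C - #(A ∩ C) := card_sdiff_of_subset inter_subset_right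
  have hIA : #(A ∩ C) ≤ #A := card_le_card inter_subset_left
  rw [hsum, ← hCB]
  rcases le_or_gt t #(A ∩ C) with hI | hI
  · have := ih #(A ∩ C) (by omega) (A ∪ C) (A ∩ C) t (by omega) hI rfl
    rw [hUI] at this
    refine this.trans (sum_le_sum fun x _ ↦ min_le_min le_rfl ?_)
    rw [repCount_eq_union_inter_add A C]
    omega
  · have h1 := ih #(C \ (A ∩ C)) (by omega) (A \ (A ∩ C)) (C \ (A ∩ C)) (t - #(A ∩ C))
      (by omega) (by omega) rfl
    have h2 : ∑ x, repCount (A ∪ C) (A ∩ C) x = #(A ∪ C) * #(A ∩ C) := sum_repCount _ _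
    have h3 : ∑ x, repCount (A ∪ C) (A ∩ C) x + ∑ x, min (t - #(A ∩ C))
        (repCount (A \ (A ∩ C)) (C \ (A ∩ C)) x) ≤ ∑ x, min t (repCount A C x) := by
      rw [← sum_add_distrib]
      refine sum_le_sum fun x _ ↦ ?_
      have := repCount_le_left (A ∩ C) (A ∪ C) x
      rw [repCount_comm] at this
      rw [repCount_eq_union_inter_add A C]
      omega
    refine le_trans ?_ h3
    refine le_trans ?_ (Nat.add_le_add_left h1 _)
    have hU : #(A ∪ C) ≤ p := by simpa using card_le_univ (A ∪ C)
    have h4 : #(A \ (A ∩ C)) + #(C \ (A ∩ C)) - (t - #(A ∩ C)) = #(A ∪ C) - t := by omega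
    rw [h2, h4, min_eq_right (by omega : #(A ∪ C) - t ≤ p)]
    refine (Nat.mul_le_mul_left t (min_le_right _ _)).trans ?_
    rw [← hUI]
    obtain ⟨u, hu⟩ := Nat.exists_eq_add_of_le (hA.trans hAU)
    obtain ⟨s, hs⟩ := Nat.exists_eq_add_of_le hI.le
    rw [hu]
    generalize #(A ∩ C) = i at *
    subst hs
    rw [show i + s + u + i - (i + s) = u + i by omega, Nat.add_sub_cancel_left,
      Nat.add_sub_cancel_left]
    nlinarith

/-! ### Popular sums in `ZMod p` -/

/-- The number of ways to write `x` as an ordered sum of `k` elements of `B`. -/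
def sumReps {G : Type*} [AddCommGroup G] [DecidableEq G] (B : Finset G) (k : ℕ) (x : G) : ℕ :=
  #{v ∈ Fintype.piFinset fun _ : Fin k ↦ B | ∑ i, v i = x}

lemma sumReps_succ {G : Type*} [AddCommGroup G] [DecidableEq G] (B : Finset G) (k : ℕ) (x : G) :
    sumReps B (k + 1) x = ∑ b ∈ B, sumReps B k (x - b) := by
  simp only [sumReps]
  rw [← card_sigma]
  refine card_bij' (fun v _ ↦ ⟨v 0, Fin.tail v⟩) (fun w _ ↦ Fin.cons w.1 w.2) ?_ ?_ ?_ ?_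
  · intro v hv
    simp only [mem_filter, Fintype.mem_piFinset, mem_sigma] at hv ⊢
    refine ⟨hv.1 0, fun i ↦ hv.1 i.succ, ?_⟩
    rw [← hv.2, Fin.sum_univ_succ, add_sub_cancel_left]
    rfl
  · rintro ⟨b, w⟩ hw
    simp only [mem_filter, Fintype.mem_piFinset, mem_sigma] at hw ⊢
    refine ⟨fun i ↦ ?_, ?_⟩
    · refine Fin.cases ?_ (fun i ↦ ?_) i
      · simpa using hw.1
      · simpa using hw.2.1 i
    · rw [Fin.sum_univ_succ]
      simp [hw.2.2]
  · intro v _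
    simp
  · rintro ⟨b, w⟩ _
    simp

lemma repCount_mul_le_sumReps_succ {G : Type*} [AddCommGroup G] [DecidableEq G]
    (S B : Finset G) (k : ℕ) (r : ℝ) (hS : ∀ s ∈ S, r ≤ sumReps B k s) (x : G) :
    repCount S B x * r ≤ sumReps B (k + 1) x := by
  rw [sumReps_succ, repCount_comm, repCount_eq_card_filter, ← nsmul_eq_mul, ← sum_const]
  push_cast
  refine (sum_le_sum fun b hb ↦ hS _ (mem_filter.1 hb).2).trans ?_
  exact sum_le_sum_of_subset_of_nonneg (filter_subset _ _) fun _ _ _ ↦ Nat.cast_nonneg _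

/-- A popular version of the Cauchy–Davenport inequality: the set of elements with many
representations is almost as large as the sumset has to be. -/
lemma ZMod.card_popular_ge {p : ℕ} [Fact p.Prime] (S B : Finset (ZMod p)) {η : ℝ} (hη : 0 < η)
    (hp : 1 ≤ η * p) (hS : 2 * η * p ≤ #S) (hB : 2 * η * p ≤ #B) :
    min (p : ℝ) (#S + #B) - 3 * η * p ≤
      #{x : ZMod p | η ^ 2 * p ≤ (repCount S B x : ℝ)} := by
  set t := ⌈η * p⌉₊ with ht
  have ht1 : η * p ≤ t := Nat.le_ceil _
  have ht2 : (t : ℝ) ≤ 2 * η * p := by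
    have := (Nat.ceil_lt_add_one (by linarith : 0 ≤ η * p)).le
    linarith
  have hp0 : (0 : ℝ) < p := by
    by_contra! h
    nlinarith
  have hpol := ZMod.pollard S B t (by exact_mod_cast ht2.trans hS) (by exact_mod_cast ht2.trans hB)
  set P : Finset (ZMod p) := {x : ZMod p | η ^ 2 * p ≤ (repCount S B x : ℝ)} with hP
  have hup : ((∑ x, min t (repCount S B x) : ℕ) : ℝ) ≤ t * #P + η ^ 2 * p * p := by
    push_cast
    rw [← sum_add_sum_compl P]
    refine add_le_add ?_ ?_
    · rw [mul_comm, ← nsmul_eq_mul, ← sum_const]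
      exact sum_le_sum fun x _ ↦ min_le_left _ _
    · have h1 : ∑ x ∈ Pᶜ, min (t : ℝ) (repCount S B x) ≤ ∑ x ∈ Pᶜ, η ^ 2 * p := by
        refine sum_le_sum fun x hx ↦ (min_le_right _ _).trans ?_
        simp only [hP, mem_compl, mem_filter, mem_univ, true_and, not_le] at hx
        exact hx.le
      refine h1.trans ?_
      rw [sum_const, nsmul_eq_mul, mul_comm]
      gcongr
      simpa using card_le_univ Pᶜ
  have hmin : min (p : ℝ) (#S + #B) - t ≤ (min p (#S + #B - t) : ℕ) := by
    push_cast
    rw [le_min_iff]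
    refine ⟨?_, ?_⟩
    · have := min_le_left (p : ℝ) (#S + #B)
      have : (0 : ℝ) ≤ t := Nat.cast_nonneg _
      linarith
    · have := min_le_right (p : ℝ) (#S + #B)
      rw [Nat.cast_sub (le_add_right (by exact_mod_cast ht2.trans hS))]
      push_cast
      linarith
  have hpol' : (t : ℝ) * (min p (#S + #B - t) : ℕ) ≤ t * #P + η ^ 2 * p * p :=
    le_trans (by exact_mod_cast hpol) hup
  have h5 : η ^ 2 * p * p ≤ t * (η * p) := by
    nlinarith [mul_le_mul_of_nonneg_right ht1 (by positivity : 0 ≤ η * p)]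
  have htpos : (0 : ℝ) < t := by linarith
  have h6 : ((min p (#S + #B - t) : ℕ) : ℝ) ≤ #P + η * p := by
    refine le_of_mul_le_mul_left ?_ htpos
    linarith [hpol']
  linarith

lemma ZMod.card_add_card_sub_le_repCount {p : ℕ} [NeZero p] (S B : Finset (ZMod p)) (x : ZMod p) :
    (#S + #B : ℝ) - p ≤ repCount S B x := by
  rw [repCount_eq_card_filter]
  have h1 : #(S.filter fun a ↦ x - a ∈ B) = #(S ∩ B.map (Equiv.subLeft x).toEmbedding) := by
    congr 1
    ext a
    simp only [mem_filter, mem_inter, mem_map_equiv, and_congr_right_iff]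
    intro _
    simp [Equiv.subLeft, neg_add_eq_sub]
  have h2 := card_union_add_card_inter S (B.map (Equiv.subLeft x).toEmbedding)
  have h3 : #(S ∪ B.map (Equiv.subLeft x).toEmbedding) ≤ p := by
    simpa using card_le_univ (S ∪ B.map (Equiv.subLeft x).toEmbedding)
  rw [card_map] at h2
  rw [h1]
  have : (#(S ∪ B.map (Equiv.subLeft x).toEmbedding) : ℝ) +
    #(S ∩ B.map (Equiv.subLeft x).toEmbedding) = #S + #B := by exact_mod_cast h2
  have : (#(S ∪ B.map (Equiv.subLeft x).toEmbedding) : ℝ) ≤ p := by exact_mod_cast h3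
  linarith

/-- The set of popular `j + 1`-fold sums of a dense set grows linearly in `j`. -/
lemma ZMod.exists_popular_sums {η : ℝ} (hη : 0 < η) (hη' : 8 * η ≤ 1) (j : ℕ) :
    ∃ c : ℝ, 0 < c ∧ ∀ p : ℕ, p.Prime → 1 ≤ η * p → ∀ B : Finset (ZMod p), 8 * η * p ≤ #B →
      ∃ S : Finset (ZMod p), min ((1 - 3 * η) * p) ((8 + 5 * j) * η * p) ≤ #S ∧
        ∀ s ∈ S, c * (p : ℝ) ^ j ≤ sumReps B (j + 1) s := by
  induction j with
  | zero =>
    refine ⟨1, one_pos, fun p hp hp1 B hB ↦ ⟨B, ?_, fun s hs ↦ ?_⟩⟩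
    · exact (min_le_right _ _).trans (by simpa using hB)
    · have : 0 < sumReps B 1 s := by
        refine card_pos.2 ⟨fun _ ↦ s, ?_⟩
        simp [hs]
      have : (1 : ℝ) ≤ sumReps B 1 s := by exact_mod_cast this
      simpa using this
  | succ j ih =>
    obtain ⟨c, hc, h⟩ := ih
    refine ⟨η ^ 2 * c, by positivity, fun p hp hp1 B hB ↦ ?_⟩
    have : Fact p.Prime := ⟨hp⟩
    obtain ⟨S, hS, hSr⟩ := h p hp hp1 B hB
    have hpp : (0 : ℝ) < p := by exact_mod_cast hp.pos
    have hηp : 0 < η * p := by positivity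
    have hS' : 5 * η * p ≤ #S := by
      refine le_trans (le_min ?_ ?_) hS
      · nlinarith
      · have : (0 : ℝ) ≤ j * (η * p) := by positivity
        nlinarith
    refine ⟨univ.filter fun x ↦ η ^ 2 * p ≤ (repCount S B x : ℝ), ?_, fun s hs ↦ ?_⟩
    · have h1 := ZMod.card_popular_ge S B hη hp1 (by linarith) (by linarith)
      refine le_trans ?_ h1
      rw [le_sub_iff_add_le]
      push_cast
      refine le_min ?_ ?_
      · have := min_le_left ((1 - 3 * η) * p) ((8 + 5 * (j + 1)) * η * p)
        linarith
      · rcases min_cases ((1 - 3 * η) * p) ((8 + 5 * j) * η * p) with ⟨h2, _⟩ | ⟨h2, _⟩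
        · have := min_le_left ((1 - 3 * η) * p) ((8 + 5 * (j + 1)) * η * p)
          linarith
        · have := min_le_right ((1 - 3 * η) * p) ((8 + 5 * (j + 1)) * η * p)
          linarith
    · have h2 := repCount_mul_le_sumReps_succ S B (j + 1) _ hSr s
      refine le_trans ?_ h2
      rw [mem_filter] at hs
      calc η ^ 2 * c * (p : ℝ) ^ (j + 1) = η ^ 2 * p * (c * (p : ℝ) ^ j) := by ring
        _ ≤ _ := by gcongr; exact hs.2

/-- A subset of `ZMod p` of density `d` is a basis of bounded order, in the strong sense that
every residue has a positive proportion of all possible representations. -/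
theorem ZMod.exists_sumReps_ge {d : ℝ} (hd : 0 < d) (hd1 : d ≤ 1) :
    ∃ k : ℕ, ∃ c : ℝ, 0 < c ∧ ∀ p : ℕ, p.Prime → 8 ≤ d * p →
      ∀ B : Finset (ZMod p), d * p ≤ #B → ∀ x, c * (p : ℝ) ^ k ≤ sumReps B (k + 1) x := by
  set η := d / 8 with hη
  obtain ⟨j, hj⟩ := exists_nat_gt (1 / η)
  have hη0 : 0 < η := by positivity
  obtain ⟨c, hc, h⟩ := ZMod.exists_popular_sums hη0 (by linarith) j
  refine ⟨j + 1, 5 * η * c, by positivity, fun p hp hp8 B hB x ↦ ?_⟩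
  have : Fact p.Prime := ⟨hp⟩
  have hpp : (0 : ℝ) < p := by exact_mod_cast hp.pos
  have hηp : 0 < η * p := by positivity
  obtain ⟨S, hS, hSr⟩ := h p hp (by rw [hη]; linarith) B (by rw [hη]; linarith)
  have hS' : (1 - 3 * η) * p ≤ #S := by
    refine le_trans (le_min le_rfl ?_) hS
    have : 1 ≤ j * η := by rw [div_lt_iff₀ hη0] at hj; exact hj.le
    nlinarith
  have h1 := ZMod.card_add_card_sub_le_repCount S B x
  have h2 := repCount_mul_le_sumReps_succ S B (j + 1) _ hSr x
  refine le_trans ?_ h2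
  calc 5 * η * c * (p : ℝ) ^ (j + 1) = 5 * η * p * (c * (p : ℝ) ^ j) := by ring
    _ ≤ _ := by
      gcongr
      have : d * p = 8 * η * p := by rw [hη]; ring
      linarith

/-! ### Sums of dense sets of integers -/

/-- Rounding `a ↦ ⌊a p / D⌋` turns a congruence modulo `p` into one modulo `D`, up to an error
bounded by the number of summands. -/
lemma exists_add_mul_mem_Icc {ι : Type*} (s : Finset ι) (b : ι → ℕ) {p D t : ℕ} (hD : 0 < D)
    (hDp : D ≤ p) (hst : ∑ i ∈ s, b i ≤ t)
    (h : ((∑ i ∈ s, b i * p / D : ℕ) : ZMod p) = (t * p / D : ℕ)) :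
    ∃ i : ℕ, t ≤ ∑ i ∈ s, b i + i * D ∧ ∑ i ∈ s, b i + i * D ≤ t + #s := by
  have hp : 0 < p := hD.trans_le hDp
  have hlow : (∑ i ∈ s, b i * p / D) * D ≤ (∑ i ∈ s, b i) * p := by
    rw [sum_mul, sum_mul]
    exact sum_le_sum fun i _ ↦ Nat.div_mul_le_self _ _
  have hup : (∑ i ∈ s, b i) * p ≤ (∑ i ∈ s, b i * p / D + #s) * D := by
    rw [sum_mul, card_eq_sum_ones, ← sum_add_distrib, sum_mul]
    exact sum_le_sum fun i _ ↦ (Nat.lt_div_mul_add hD).le.trans (by rw [add_mul, one_mul])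
  have htlow : t * p / D * D ≤ t * p := Nat.div_mul_le_self _ _
  have htup : t * p < t * p / D * D + D := Nat.lt_div_mul_add hD
  have hle : ∑ i ∈ s, b i * p / D ≤ t * p / D := by
    rw [Nat.le_div_iff_mul_le hD]
    exact hlow.trans (Nat.mul_le_mul_right _ hst)
  rw [ZMod.natCast_eq_natCast_iff, Nat.modEq_iff_dvd' hle] at h
  obtain ⟨i, hi⟩ := h
  have hi' : t * p / D = ∑ i ∈ s, b i * p / D + p * i := by omega
  rw [hi'] at htlow htup
  refine ⟨i, ?_, ?_⟩
  · refine Nat.lt_add_one_iff.1 (lt_of_mul_lt_mul_right ?_ (Nat.zero_le p))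
    nlinarith
  · refine le_of_mul_le_mul_right ?_ hp
    have : #s * D ≤ #s * p := Nat.mul_le_mul_left _ hDp
    nlinarith

/-- Rounding `a ↦ ⌊a p / D⌋` is injective modulo `p` on intervals much shorter than `D`. -/
lemma injOn_mul_div_zmod {p D h : ℕ} (hD : 6 * h ≤ D) (hDp : D ≤ p) (hh : 2 ≤ h) :
    Set.InjOn (fun a : ℕ ↦ ((a * p / D : ℕ) : ZMod p)) (Set.Ioc h (2 * h)) := by
  have hD0 : 0 < D := by omega
  have key : ∀ a ∈ Set.Ioc h (2 * h), ∀ a' ∈ Set.Ioc h (2 * h), a < a' →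
      ((a * p / D : ℕ) : ZMod p) ≠ (a' * p / D : ℕ) := by
    intro a ha a' ha' haa' heq
    have hlt : a * p / D < a' * p / D := by
      rw [Nat.lt_iff_add_one_le, Nat.le_div_iff_mul_le hD0]
      have := Nat.div_mul_le_self (a * p) D
      nlinarith
    rw [ZMod.natCast_eq_natCast_iff, Nat.modEq_iff_dvd' hlt.le] at heq
    have h1 := Nat.le_of_dvd (by omega) heq
    have h2 : a' * p / D * D ≤ a' * p := Nat.div_mul_le_self _ _
    have h3 : a * p < a * p / D * D + D := Nat.lt_div_mul_add hD0
    have h4 : (a * p / D + p) * D ≤ a' * p / D * D := Nat.mul_le_mul_right _ (by omega)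
    have h5 : a' ≤ a + h := by have := ha.1; have := ha'.2; omega
    have h6 : a' * p ≤ (a + h) * p := Nat.mul_le_mul_right _ h5
    have h7 : 6 * h * p ≤ D * p := Nat.mul_le_mul_right _ hD
    nlinarith
  intro a ha a' ha' heq
  rcases lt_trichotomy a a' with hlt | rfl | hlt
  · exact absurd heq (key a ha a' ha' hlt)
  · rfl
  · exact absurd heq.symm (key a' ha' a ha hlt)

/-- A popular difference between two dense sets. -/
lemma exists_popular_difference {d : ℝ} {h : ℕ} (hd : 0 < d) (hh : 1 ≤ h) {A₁ A₂ : Finset ℕ}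
    (hA₁ : A₁ ⊆ Ioc h (2 * h)) (hA₂ : A₂ ⊆ Ioc (8 * h) (16 * h))
    (h₁ : d * h ≤ #A₁) (h₂ : d * h ≤ #A₂) :
    ∃ D ∈ Icc (6 * h) (15 * h), d ^ 2 / 10 * h ≤ (#{e ∈ A₁ | e + D ∈ A₂} : ℝ) := by
  have hh' : (1 : ℝ) ≤ h := by exact_mod_cast hh
  obtain ⟨D, hD, hcard⟩ := exists_le_card_fiber_of_nsmul_le_card_of_maps_to
    (s := A₁ ×ˢ A₂) (t := Icc (6 * h) (15 * h)) (f := fun x ↦ x.2 - x.1) (b := d ^ 2 / 10 * h)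
    (by
      intro x hx
      rw [mem_product] at hx
      have a1 := mem_Ioc.1 (hA₁ hx.1)
      have a2 := mem_Ioc.1 (hA₂ hx.2)
      rw [mem_Icc]; omega)
    ⟨6 * h, by rw [mem_Icc]; omega⟩
    (by
      rw [Nat.card_Icc, card_product, nsmul_eq_mul, show 15 * h + 1 - 6 * h = 9 * h + 1 by omega]
      push_cast
      calc (9 * (h : ℝ) + 1) * (d ^ 2 / 10 * h) ≤ (10 * h) * (d ^ 2 / 10 * h) := by
            gcongr; linarith
        _ = (d * h) * (d * h) := by ring
        _ ≤ _ := by gcongr)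
  refine ⟨D, hD, hcard.trans ?_⟩
  norm_cast
  refine card_le_card_of_injOn Prod.fst ?_ ?_
  · intro x hx
    simp only [coe_filter, mem_product, Set.mem_ofPred_eq] at hx ⊢
    have a1 := mem_Ioc.1 (hA₁ hx.1.1)
    have a2 := mem_Ioc.1 (hA₂ hx.1.2)
    refine ⟨hx.1.1, ?_⟩
    rw [show x.1 + D = x.2 by omega]
    exact hx.1.2
  · intro x hx y hy hxy
    simp only [coe_filter, mem_product, Set.mem_ofPred_eq] at hx hy
    have a1 := mem_Ioc.1 (hA₁ hx.1.1)
    have a2 := mem_Ioc.1 (hA₂ hx.1.2)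
    have b1 := mem_Ioc.1 (hA₁ hy.1.1)
    have b2 := mem_Ioc.1 (hA₂ hy.1.2)
    refine Prod.ext hxy ?_
    omega

/-- The sums of `2 k` elements of a set `A` which is dense in `(h, 2 h]` and in `(8 h, 16 h]` are
well distributed around every `N` in the middle of their range: up to a bounded error in `N`,
a positive proportion of the expected number of representations is present. -/
theorem exists_card_sums_ge {d : ℝ} (hd : 0 < d) (hd1 : d ≤ 1) :
    ∃ k : ℕ, 0 < k ∧ ∃ c : ℝ, 0 < c ∧ ∃ H : ℕ, ∀ h ≥ H, ∀ A : Finset ℕ,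
      d * h ≤ #(A ∩ Ioc h (2 * h)) → d * h ≤ #(A ∩ Ioc (8 * h) (16 * h)) →
      ∀ N : ℕ, 4 * k * h ≤ N → N ≤ 7 * k * h →
        c * (h : ℝ) ^ (2 * k - 1) ≤
          #{w ∈ (Fintype.piFinset fun _ : Fin k ↦ A) ×ˢ (Fintype.piFinset fun _ : Fin k ↦ A) |
            ∑ i, w.1 i + ∑ i, w.2 i ∈ Icc N (N + k)} := by
  obtain ⟨k, c, hc, hk⟩ := ZMod.exists_sumReps_ge (d := d / 30) (by positivity) (by linarith)
  set K := k + 1 with hK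
  -- `2 K` elements of `(h, 2 h]` have a sum between `2 K h` and `4 K h`; as `D ≥ 6 h`, adding up to
  -- `K` times `D` reaches every `N ∈ [4 K h, 7 K h]`.
  refine ⟨K, by omega, (d ^ 2 / 10) ^ K * (c * 15 ^ k) / (K + 1), by positivity,
    max 2 ⌈16 / d⌉₊, fun h hh A h₁ h₂ N hN hN' ↦ ?_⟩
  have hh2 : 2 ≤ h := (le_max_left _ _).trans hh
  have hhd : 16 ≤ d * h := by
    have : 16 / d ≤ h := (Nat.le_ceil _).trans (by exact_mod_cast (le_max_right _ _).trans hh)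
    rw [div_le_iff₀ hd] at this
    linarith
  obtain ⟨D, hD, hE⟩ := exists_popular_difference hd (by omega) inter_subset_right
    inter_subset_right h₁ h₂
  set A₁ := A ∩ Ioc h (2 * h) with hA₁
  set A₂ := A ∩ Ioc (8 * h) (16 * h) with hA₂
  set E := {e ∈ A₁ | e + D ∈ A₂} with hEdef
  rw [mem_Icc] at hD
  obtain ⟨p, hp, hp1, hp2⟩ := Nat.exists_prime_lt_and_le_two_mul (15 * h) (by omega)
  have : Fact p.Prime := ⟨hp⟩
  have hp1' : 15 * (h : ℝ) ≤ p := by exact_mod_cast hp1.le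
  have hp2' : (p : ℝ) ≤ 30 * h := by
    have : (p : ℝ) ≤ 2 * (15 * h) := by exact_mod_cast hp2
    linarith
  set φ : ℕ → ℕ := fun a ↦ a * p / D with hφ
  set B : Finset (ZMod p) := A₁.image fun a ↦ (φ a : ZMod p) with hB
  have hBcard : #B = #A₁ := card_image_of_injOn
    ((injOn_mul_div_zmod hD.1 (by omega) hh2).mono fun a ha ↦ by
      simpa using (mem_inter.1 ha).2)
  have hBd : d / 30 * p ≤ #B := by
    rw [hBcard]
    refine le_trans ?_ h₁
    calc d / 30 * p ≤ d / 30 * (30 * h) := by gcongr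
      _ = d * h := by ring
  have hrep := hk p hp (by nlinarith) B hBd
  -- Pairs `(b, e)` whose sum is `N` modulo `D`, up to rounding.
  set Ω := {w ∈ (Fintype.piFinset fun _ : Fin K ↦ A₁) ×ˢ (Fintype.piFinset fun _ : Fin K ↦ E) |
    ((∑ i, φ (w.1 i) : ℕ) : ZMod p) = (φ (N - ∑ i, w.2 i) : ℕ)} with hΩ
  have hΩcard : (#E : ℝ) ^ K * (c * (p : ℝ) ^ k) ≤ #Ω := by
    have h1 : #Ω = ∑ e ∈ Fintype.piFinset fun _ : Fin K ↦ E,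
        #{b ∈ Fintype.piFinset fun _ : Fin K ↦ A₁ |
          ((∑ i, φ (b i) : ℕ) : ZMod p) = (φ (N - ∑ i, e i) : ℕ)} := by
      rw [hΩ, card_filter, sum_product_right]
      exact sum_congr rfl fun e _ ↦ (card_filter _ _).symm
    rw [h1]
    push_cast
    rw [← Nat.cast_pow, ← Fintype.card_piFinset_const, ← nsmul_eq_mul, ← sum_const]
    refine sum_le_sum fun e _ ↦ (hrep (φ (N - ∑ i, e i) : ℕ)).trans ?_
    norm_cast
    refine card_le_card_of_surjOn (fun b i ↦ (φ (b i) : ZMod p)) ?_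
    intro v hv
    simp only [coe_filter, Fintype.mem_piFinset, Set.mem_ofPred_eq, hB, mem_image] at hv
    choose b hb hbv using hv.1
    refine ⟨b, ?_, funext hbv⟩
    simp only [coe_filter, Fintype.mem_piFinset, Set.mem_ofPred_eq]
    refine ⟨hb, ?_⟩
    rw [← hv.2]
    push_cast
    exact sum_congr rfl fun i _ ↦ hbv i
  have hA₁mem : ∀ a ∈ A₁, a ∈ A ∧ h + 1 ≤ a ∧ a ≤ 2 * h := fun a ha ↦ by
    rw [hA₁, mem_inter, mem_Ioc] at ha
    exact ⟨ha.1, ha.2.1, ha.2.2⟩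
  have hsum : ∀ v : Fin K → ℕ, (∀ i, v i ∈ A₁) →
      K * (h + 1) ≤ ∑ i, v i ∧ ∑ i, v i ≤ K * (2 * h) := fun v hv ↦ by
    constructor
    · simpa using card_nsmul_le_sum univ v (h + 1) fun i _ ↦ (hA₁mem _ (hv i)).2.1
    · simpa using sum_le_card_nsmul univ v (2 * h) fun i _ ↦ (hA₁mem _ (hv i)).2.2
  -- Such a pair reaches `N` once `i` of the `e`'s have been moved by `D`.
  have hshift : ∀ w ∈ Ω, ∃ i ≤ K, ∑ j, w.1 j + ∑ j, w.2 j + i * D ∈ Icc N (N + K) := by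
    intro w hw
    rw [hΩ, mem_filter, mem_product, Fintype.mem_piFinset, Fintype.mem_piFinset] at hw
    have s1 := hsum w.1 hw.1.1
    have s2 := hsum w.2 fun i ↦ (mem_filter.1 (hw.1.2 i)).1
    obtain ⟨i, hi1, hi2⟩ := exists_add_mul_mem_Icc univ w.1 (p := p) (D := D)
      (t := N - ∑ i, w.2 i) (by omega) (by omega)
      (by
        have : K * (2 * h) + K * (2 * h) = 4 * K * h := by ring
        omega) hw.2
    rw [card_univ, Fintype.card_fin] at hi2
    refine ⟨i, ?_, ?_⟩
    · by_contra! hiK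
      have h1 : (K + 1) * (6 * h) ≤ i * D := Nat.mul_le_mul hiK hD.1
      have h2 : (K + 1) * (6 * h) = 6 * (K * h) + 6 * h := by ring
      have h3 : 7 * K * h = 7 * (K * h) := by ring
      have h4 : K * (h + 1) = K * h + K := by ring
      omega
    · rw [mem_Icc]
      have : K * (2 * h) + K * (2 * h) = 4 * K * h := by ring
      omega
  choose! i hiK hi using hshift
  have hmain : #Ω ≤ #(range (K + 1) ×ˢ {w ∈ (Fintype.piFinset fun _ : Fin K ↦ A) ×ˢ
      (Fintype.piFinset fun _ : Fin K ↦ A) | ∑ i, w.1 i + ∑ i, w.2 i ∈ Icc N (N + K)}) := by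
    refine card_le_card_of_injOn
      (fun w ↦ (i w, (w.1, fun j ↦ w.2 j + if (j : ℕ) < i w then D else 0))) ?_ ?_
    · intro w hw
      have hw' := hw
      rw [mem_coe, hΩ, mem_filter, mem_product, Fintype.mem_piFinset, Fintype.mem_piFinset] at hw'
      have hsumD : ∑ j : Fin K, (if (j : ℕ) < i w then D else 0) = i w * D := by
        rw [← sum_filter, sum_const, smul_eq_mul]
        congr 1
        have := hiK w hw
        rw [Fin.card_filter_val_lt, min_eq_right this]
      simp only [coe_product, Set.mem_prod, mem_coe, mem_range, mem_filter, mem_product,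
        Fintype.mem_piFinset]
      refine ⟨Nat.lt_succ_of_le (hiK w hw), ⟨fun j ↦ (hA₁mem _ (hw'.1.1 j)).1, fun j ↦ ?_⟩, ?_⟩
      · have hj := mem_filter.1 (hw'.1.2 j)
        split_ifs
        · exact (mem_inter.1 hj.2).1
        · exact (hA₁mem _ hj.1).1
      · rw [sum_add_distrib, hsumD]
        simpa only [add_assoc] using hi w hw
    · intro w _ w' _ hww'
      simp only [Prod.mk.injEq] at hww'
      obtain ⟨h1, h2, h3⟩ := hww'
      refine Prod.ext h2 (funext fun j ↦ ?_)
      have := congrFun h3 j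
      rw [h1] at this
      exact Nat.add_right_cancel this
  rw [card_product, card_range] at hmain
  have hmain' : (#Ω : ℝ) ≤ (K + 1) * #{w ∈ (Fintype.piFinset fun _ : Fin K ↦ A) ×ˢ
      (Fintype.piFinset fun _ : Fin K ↦ A) | ∑ i, w.1 i + ∑ i, w.2 i ∈ Icc N (N + K)} := by
    exact_mod_cast hmain
  rw [div_mul_eq_mul_div, div_le_iff₀ (by positivity), mul_comm _ ((K : ℝ) + 1)]
  refine le_trans ?_ (hΩcard.trans hmain')
  calc (d ^ 2 / 10) ^ K * (c * 15 ^ k) * (h : ℝ) ^ (2 * K - 1)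
      = (d ^ 2 / 10 * h) ^ K * (c * (15 * h) ^ k) := by
        rw [show 2 * K - 1 = K + k by omega]
        ring
    _ ≤ _ := by gcongr

/-! ### Primes in logarithmic cells -/

/-- The primes `p` with `exp (j - 1) < p ≤ exp j`. -/
noncomputable def primeCell (j : ℕ) : Finset ℕ :=
  {p ∈ Icc 1 ⌊Real.exp j⌋₊ | p.Prime ∧ Real.exp (j - 1) < p}

lemma mem_primeCell {j p : ℕ} :
    p ∈ primeCell j ↔ p.Prime ∧ Real.exp (j - 1) < p ∧ (p : ℝ) ≤ Real.exp j := by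
  rw [primeCell, mem_filter, mem_Icc, Nat.le_floor_iff (Real.exp_pos _).le]
  constructor
  · rintro ⟨⟨_, h1⟩, h2, h3⟩
    exact ⟨h2, h3, h1⟩
  · rintro ⟨h2, h3, h1⟩
    exact ⟨⟨h2.one_le, h1⟩, h2, h3⟩

lemma mem_primeCell_iff_log {j p : ℕ} :
    p ∈ primeCell j ↔ p.Prime ∧ (j : ℝ) - 1 < Real.log p ∧ Real.log p ≤ j := by
  rw [mem_primeCell]
  refine and_congr_right fun hp ↦ ?_
  have : (0 : ℝ) < p := by exact_mod_cast hp.pos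
  rw [Real.lt_log_iff_exp_lt this, Real.log_le_iff_le_exp this]

lemma eq_of_mem_primeCell {i j p : ℕ} (hi : p ∈ primeCell i) (hj : p ∈ primeCell j) : i = j := by
  rw [mem_primeCell_iff_log] at hi hj
  have h1 : (i : ℝ) < j + 1 := by linarith
  have h2 : (j : ℝ) < i + 1 := by linarith
  norm_cast at h1 h2
  omega

lemma mem_primeCell_ceil_log {p : ℕ} (hp : p.Prime) : p ∈ primeCell ⌈Real.log p⌉₊ := by
  rw [mem_primeCell_iff_log]
  have := Nat.ceil_lt_add_one (Real.log_nonneg (by exact_mod_cast hp.one_le : (1 : ℝ) ≤ p))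
  exact ⟨hp, by linarith, Nat.le_ceil _⟩

lemma pairwiseDisjoint_primeCell (s : Set ℕ) : s.PairwiseDisjoint primeCell := by
  intro i _ j _ hij
  exact disjoint_left.2 fun p hi hj ↦ hij (eq_of_mem_primeCell hi hj)

/-- Chebyshev's bound on a single cell. -/
lemma sum_primeCell_log_div_le (j : ℕ) :
    ∑ p ∈ primeCell j, Real.log p / p ≤ Real.exp 1 * Real.log 4 := by
  have h1 : ∑ p ∈ primeCell j, Real.log p / p ≤
      ∑ p ∈ primeCell j, Real.log p * Real.exp (1 - j) := by
    refine sum_le_sum fun p hp ↦ ?_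
    rw [mem_primeCell] at hp
    rw [div_eq_mul_inv]
    have : (0 : ℝ) ≤ Real.log p := Real.log_natCast_nonneg p
    gcongr
    rw [show (1 : ℝ) - j = -(j - 1) by ring, Real.exp_neg]
    gcongr
    exact hp.2.1.le
  have h2 : ∑ p ∈ primeCell j, Real.log p ≤ Chebyshev.theta (Real.exp j) := by
    rw [Chebyshev.theta_eq_sum_Icc]
    refine sum_le_sum_of_subset_of_nonneg ?_ fun p _ _ ↦ Real.log_natCast_nonneg p
    intro p hp
    rw [primeCell, mem_filter, mem_Icc] at hp
    rw [mem_filter, mem_Icc]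
    exact ⟨⟨by omega, hp.1.2⟩, hp.2.1⟩
  have h3 := Chebyshev.theta_le_log4_mul_x (Real.exp_pos j).le
  rw [← sum_mul] at h1
  calc _ ≤ _ := h1
    _ ≤ (Real.log 4 * Real.exp j) * Real.exp (1 - j) := by gcongr; exact h2.trans h3
    _ = Real.log 4 * Real.exp (j + (1 - j)) := by rw [Real.exp_add]; ring
    _ = _ := by rw [add_sub_cancel, mul_comm]

/-- Mertens' upper bound, with an unspecified constant. -/
lemma exists_sum_log_div_le : ∃ C : ℝ, 0 < C ∧ ∀ x : ℝ, 2 ≤ x →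
    ∑ p ∈ (Icc 1 ⌊x⌋₊).filter Nat.Prime, Real.log p / p ≤ C * Real.log x := by
  have h4 : 0 < Real.log 4 := Real.log_pos (by norm_num)
  refine ⟨5 * (Real.exp 1 * Real.log 4), by positivity, fun x hx ↦ ?_⟩
  have hlog : 1 / 2 ≤ Real.log x := by
    have := Real.log_two_gt_d9
    have := Real.log_le_log two_pos hx
    linarith
  have hsub : (Icc 1 ⌊x⌋₊).filter Nat.Prime ⊆
      (range (⌈Real.log x⌉₊ + 1)).biUnion primeCell := by
    intro p hp
    rw [mem_filter, mem_Icc, Nat.le_floor_iff (by linarith)] at hp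
    rw [mem_biUnion]
    refine ⟨_, ?_, mem_primeCell_ceil_log hp.2⟩
    rw [mem_range, Nat.lt_succ_iff]
    exact Nat.ceil_le_ceil (Real.log_le_log (by exact_mod_cast hp.2.pos) hp.1.2)
  have hnn : ∀ p : ℕ, 0 ≤ Real.log p / p := fun p ↦
    div_nonneg (Real.log_natCast_nonneg p) (Nat.cast_nonneg p)
  calc _ ≤ ∑ p ∈ (range (⌈Real.log x⌉₊ + 1)).biUnion primeCell, Real.log p / p :=
        sum_le_sum_of_subset_of_nonneg hsub fun p _ _ ↦ hnn p
    _ ≤ ∑ j ∈ range (⌈Real.log x⌉₊ + 1), ∑ p ∈ primeCell j, Real.log p / p :=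
        (sum_biUnion (pairwiseDisjoint_primeCell _)).le
    _ ≤ ∑ j ∈ range (⌈Real.log x⌉₊ + 1), Real.exp 1 * Real.log 4 :=
        sum_le_sum fun j _ ↦ sum_primeCell_log_div_le j
    _ = (⌈Real.log x⌉₊ + 1) * (Real.exp 1 * Real.log 4) := by simp
    _ ≤ (5 * Real.log x) * (Real.exp 1 * Real.log 4) := by
        gcongr
        have := (Nat.ceil_lt_add_one (by linarith : 0 ≤ Real.log x)).le
        linarith
    _ = _ := by ring

/-- A lower bound for the `g`-mass of the window `(exp h, exp (2 h)]` forces many cells to carry a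
positive mass, since no cell can carry more than a bounded amount. -/
lemma card_filter_primeCell_ge {g : ℕ → ℝ} (hg : ∀ n, 0 ≤ g n) {β : ℝ} (hβ : 0 < β)
    (hgβ : ∀ p : ℕ, p.Prime → g p ≤ β) {c : ℝ} (hc : 0 ≤ c) {h : ℕ}
    (hsum : c / 2 * h ≤ ∑ p ∈ (Icc 1 ⌊Real.exp (2 * h)⌋₊).filter
      (fun p : ℕ ↦ p.Prime ∧ Real.exp h < (p : ℝ)), g p * Real.log p / p) :
    c / (4 * (β * (Real.exp 1 * Real.log 4))) * h ≤
      #{j ∈ Ioc h (2 * h) | c / 4 ≤ ∑ p ∈ primeCell j, g p * Real.log p / p} := by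
  set C := β * (Real.exp 1 * Real.log 4) with hC
  have h4 : 0 < Real.log 4 := Real.log_pos (by norm_num)
  have hCpos : 0 < C := by positivity
  set w : ℕ → ℝ := fun j ↦ ∑ p ∈ primeCell j, g p * Real.log p / p with hw
  have hnn : ∀ p : ℕ, 0 ≤ g p * Real.log p / p := fun p ↦
    div_nonneg (mul_nonneg (hg p) (Real.log_natCast_nonneg p)) (Nat.cast_nonneg p)
  have hwC : ∀ j, w j ≤ C := fun j ↦ by
    calc w j ≤ ∑ p ∈ primeCell j, β * (Real.log p / p) := by
          refine sum_le_sum fun p hp ↦ ?_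
          rw [mul_div_assoc]
          have : 0 ≤ Real.log p / p :=
            div_nonneg (Real.log_natCast_nonneg p) (Nat.cast_nonneg p)
          gcongr
          exact hgβ p (mem_primeCell.1 hp).1
      _ ≤ C := by
          rw [← mul_sum, hC]
          exact mul_le_mul_of_nonneg_left (sum_primeCell_log_div_le j) hβ.le
  have h1 : c / 2 * h ≤ ∑ j ∈ Ioc h (2 * h), w j := by
    refine hsum.trans ((sum_le_sum_of_subset_of_nonneg ?_ fun p _ _ ↦ hnn p).trans
      (sum_biUnion (pairwiseDisjoint_primeCell _)).le)
    intro p hp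
    rw [mem_filter, mem_Icc, Nat.le_floor_iff (Real.exp_pos _).le] at hp
    have hp0 : (0 : ℝ) < p := by exact_mod_cast hp.2.1.pos
    rw [mem_biUnion]
    refine ⟨_, ?_, mem_primeCell_ceil_log hp.2.1⟩
    rw [mem_Ioc, Nat.lt_ceil, Nat.ceil_le, Real.lt_log_iff_exp_lt hp0,
      Real.log_le_iff_le_exp hp0]
    push_cast
    exact ⟨hp.2.2, hp.1.2⟩
  set A := {j ∈ Ioc h (2 * h) | c / 4 ≤ w j} with hA
  have hh0 : (0 : ℝ) ≤ h := Nat.cast_nonneg h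
  have h2 : ∑ j ∈ Ioc h (2 * h), w j ≤ #A * C + ∑ j ∈ Ioc h (2 * h), c / 4 := by
    rw [← sum_filter_add_sum_filter_not _ (fun j ↦ c / 4 ≤ w j) w, ← nsmul_eq_mul]
    refine add_le_add (sum_le_card_nsmul _ _ _ fun j _ ↦ hwC j) ?_
    refine (sum_le_sum fun j hj ↦ (not_le.1 (mem_filter.1 hj).2).le).trans ?_
    exact sum_le_sum_of_subset_of_nonneg (filter_subset _ _) fun _ _ _ ↦ by positivity
  rw [sum_const, Nat.card_Ioc, nsmul_eq_mul, show 2 * h - h = h by omega] at h2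
  rw [div_mul_eq_mul_div, div_le_iff₀ (by positivity)]
  linarith

/-- The sum of `∏ g (f i)` over tuples of distinct elements with `f i ∈ C i`, none of them in `Q`,
is bounded below as if the entries were independent, once finitely many elements are given up. -/
lemma prod_le_sum_injective {g : ℕ → ℝ} (hg : ∀ n, 0 ≤ g n) {β : ℝ} (hβ : 0 ≤ β) (r : ℕ)
    (C : Fin r → Finset ℕ) (hgβ : ∀ i, ∀ p ∈ C i, g p ≤ β) (L : Fin r → ℝ) (hL : ∀ i, 0 ≤ L i)
    (Q : Finset ℕ) (hLC : ∀ i, L i + (#Q + r) * β ≤ ∑ p ∈ C i, g p) :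
    ∏ i, L i ≤ ∑ f ∈ Fintype.piFinset C with Function.Injective f ∧ ∀ i, f i ∉ Q,
      ∏ i, g (f i) := by
  induction r generalizing Q with
  | zero =>
    rw [filter_true_of_mem]
    · simp
    · intro f _
      exact ⟨Function.injective_of_subsingleton f, fun i ↦ i.elim0⟩
  | succ r ih =>
    have hbij : ∑ f ∈ Fintype.piFinset C with Function.Injective f ∧ ∀ i, f i ∉ Q,
        ∏ i, g (f i) = ∑ q ∈ C 0 \ Q, ∑ f ∈ Fintype.piFinset (fun i ↦ C (Fin.succ i)) with
          Function.Injective f ∧ ∀ i, f i ∉ insert q Q, g q * ∏ i, g (f i) := by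
      rw [sum_sigma']
      refine sum_bij' (fun f _ ↦ ⟨f 0, Fin.tail f⟩) (fun w _ ↦ Fin.cons w.1 w.2) ?_ ?_ ?_ ?_ ?_
      · intro f hf
        simp only [mem_filter, Fintype.mem_piFinset, mem_sigma, mem_sdiff, mem_insert,
          not_or] at hf ⊢
        exact ⟨⟨hf.1 0, hf.2.2 0⟩, fun i ↦ hf.1 i.succ,
          hf.2.1.comp (Fin.succ_injective r), fun i ↦ ⟨fun h ↦
            Fin.succ_ne_zero i (hf.2.1 h), hf.2.2 i.succ⟩⟩
      · rintro ⟨q, f⟩ hf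
        simp only [mem_filter, Fintype.mem_piFinset, mem_sigma, mem_sdiff, mem_insert,
          not_or] at hf ⊢
        refine ⟨fun i ↦ ?_, ?_, fun i ↦ ?_⟩
        · refine Fin.cases ?_ (fun i ↦ ?_) i
          · simpa using hf.1.1
          · simpa using hf.2.1 i
        · rw [Fin.cons_injective_iff]
          exact ⟨fun ⟨i, hi⟩ ↦ (hf.2.2.2 i).1 hi, hf.2.2.1⟩
        · refine Fin.cases ?_ (fun i ↦ ?_) i
          · simpa using hf.1.2
          · simpa using (hf.2.2.2 i).2
      · intro f _; simp
      · rintro ⟨q, f⟩ _; simp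
      · intro f _
        rw [Fin.prod_univ_succ]
        rfl
    have hinner : ∀ q ∈ C 0 \ Q, g q * ∏ i : Fin r, L i.succ ≤
        ∑ f ∈ Fintype.piFinset (fun i ↦ C (Fin.succ i)) with
          Function.Injective f ∧ ∀ i, f i ∉ insert q Q, g q * ∏ i, g (f i) := by
      intro q _
      rw [← mul_sum]
      refine mul_le_mul_of_nonneg_left ?_ (hg q)
      refine ih (fun i ↦ C i.succ) (fun i ↦ hgβ i.succ) (fun i ↦ L i.succ) (fun i ↦ hL _)
        (insert q Q) fun i ↦ le_trans ?_ (hLC i.succ)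
      have : (#(insert q Q) : ℝ) ≤ #Q + 1 := by exact_mod_cast card_insert_le q Q
      push_cast
      gcongr _ + ?_ * β
      linarith
    have hC0 : L 0 ≤ ∑ q ∈ C 0 \ Q, g q := by
      have h1 : ∑ q ∈ C 0, g q = ∑ q ∈ C 0 ∩ Q, g q + ∑ q ∈ C 0 \ Q, g q :=
        (sum_inter_add_sum_sdiff _ _ _).symm
      have h2 : ∑ q ∈ C 0 ∩ Q, g q ≤ #(C 0 ∩ Q) * β := by
        rw [← nsmul_eq_mul]
        exact sum_le_card_nsmul _ _ _ fun q hq ↦ hgβ 0 q (mem_inter.1 hq).1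
      have h3 : (#(C 0 ∩ Q) : ℝ) ≤ #Q := by exact_mod_cast card_le_card inter_subset_right
      have h4 := hLC 0
      push_cast at h4
      have h5 : (#(C 0 ∩ Q) : ℝ) * β ≤ #Q * β := by gcongr
      have h6 : 0 ≤ (r + 1) * β := by positivity
      linarith
    rw [hbij, Fin.prod_univ_succ]
    refine le_trans ?_ (sum_le_sum hinner)
    rw [← sum_mul]
    exact mul_le_mul_of_nonneg_right hC0 (prod_nonneg fun i _ ↦ hL _)

lemma sum_primeCell_ge {g : ℕ → ℝ} (hg : ∀ n, 0 ≤ g n) {c : ℝ} {j : ℕ}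
    (h : c ≤ ∑ p ∈ primeCell j, g p * Real.log p / p) :
    c * Real.exp (j - 1) ≤ j * ∑ p ∈ primeCell j, g p := by
  calc c * Real.exp (j - 1) ≤
        (∑ p ∈ primeCell j, g p * Real.log p / p) * Real.exp (j - 1) := by gcongr
    _ ≤ j * ∑ p ∈ primeCell j, g p := by
      rw [sum_mul, mul_sum]
      refine sum_le_sum fun p hp ↦ ?_
      have h1 := mem_primeCell_iff_log.1 hp
      have h2 := mem_primeCell.1 hp
      have hp0 : (0 : ℝ) < p := by exact_mod_cast h1.1.pos
      rw [div_mul_eq_mul_div, div_le_iff₀ hp0]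
      have := Real.log_natCast_nonneg p
      have := hg p
      calc g p * Real.log p * Real.exp (j - 1) ≤ g p * j * p := by
            gcongr
            · exact h1.2.2
            · exact h2.2.1.le
        _ = _ := by ring

/-! ### Products of a bounded number of large primes -/

/-- The hypothesis on the prime values of `g` produces a cell set of positive lower density in
every window `(h, 2 h]`. -/
lemma exists_card_filter_primeCell_ge {g : ℕ → ℝ} (hg : ∀ n, 0 ≤ g n) {β : ℝ} (hβ : 0 < β)
    (hgβ : ∀ p : ℕ, p.Prime → g p ≤ β) {c : ℝ} (hc : 0 < c)
    (hlow : (c : EReal) ≤ Filter.liminf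
        (fun x : ℝ =>
          ((((1 - 1 / 2) * Real.log x)⁻¹ *
            ∑ p ∈ (Finset.Icc 1 ⌊x⌋₊).filter
              (fun p : ℕ => p.Prime ∧ x ^ (1 / 2 : ℝ) < (p : ℝ)),
              g p * Real.log (p : ℝ) / (p : ℝ) : ℝ) : EReal))
        Filter.atTop) :
    ∃ d : ℝ, 0 < d ∧ d ≤ 1 ∧ ∃ H : ℕ, ∀ h ≥ H, d * h ≤
      #{j ∈ Ioc h (2 * h) | c / 4 ≤ ∑ p ∈ primeCell j, g p * Real.log p / p} := by
  have h4 : 0 < Real.log 4 := Real.log_pos (by norm_num)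
  have hlt : ((c / 2 : ℝ) : EReal) < c := by
    rw [EReal.coe_lt_coe_iff]; linarith
  have hev := Filter.eventually_lt_of_lt_liminf (hlt.trans_le hlow)
  obtain ⟨X, hX⟩ := Filter.eventually_atTop.1 hev
  refine ⟨min 1 (c / (4 * (β * (Real.exp 1 * Real.log 4)))), by positivity, min_le_left _ _,
    max 1 ⌈X⌉₊, fun h hh ↦ ?_⟩
  have hh1 : (1 : ℝ) ≤ h := by exact_mod_cast (le_max_left _ _).trans hh
  have hhX : X ≤ h := (Nat.le_ceil _).trans (by exact_mod_cast (le_max_right _ _).trans hh)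
  have hXe : X ≤ Real.exp (2 * h) := by
    have := Real.add_one_le_exp (2 * (h : ℝ))
    linarith
  have key := hX _ hXe
  have hhalf : Real.exp (2 * h) ^ (1 / 2 : ℝ) = Real.exp h := by
    rw [← Real.exp_mul]; ring_nf
  rw [EReal.coe_lt_coe_iff, Real.log_exp, hhalf, show (1 - 1 / 2) * (2 * (h : ℝ)) = h by ring,
    inv_mul_eq_div, lt_div_iff₀ (by linarith)] at key
  refine le_trans ?_ (card_filter_primeCell_ge hg hβ hgβ hc.le key.le)
  gcongr
  exact min_le_right _ _

/-- Weighted count of products `∏ f i ≤ X` of exactly `r` distinct primes exceeding a fixed power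
of `X`: there are at least as many as there are primes up to `X`, up to a constant. -/
theorem exists_sum_prod_large_primes_ge {g : ℕ → ℝ} (hg : ∀ n, 0 ≤ g n) {β : ℝ} (hβ : 0 < β)
    (hgβ : ∀ p : ℕ, p.Prime → g p ≤ β) {c : ℝ} (hc : 0 < c) {d : ℝ} (hd : 0 < d) (hd1 : d ≤ 1)
    {H₀ : ℕ} (hdens : ∀ h ≥ H₀, d * h ≤
      #{j ∈ Ioc h (2 * h) | c ≤ ∑ p ∈ primeCell j, g p * Real.log p / p}) :
    ∃ r : ℕ, ∃ δ : ℝ, 0 < δ ∧ ∃ c₁ : ℝ, 0 < c₁ ∧ ∃ X₀ : ℝ, ∀ X ≥ X₀,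
      ∃ F : Finset (Fin r → ℕ),
        (∀ f ∈ F, (∀ i, (f i).Prime ∧ X ^ δ < f i) ∧ Function.Injective f ∧
          ∏ i, (f i : ℝ) ≤ X) ∧
        c₁ * X / Real.log X ≤ ∑ f ∈ F, ∏ i, g (f i) := by
  obtain ⟨k, hk, c₂, hc₂, H, hH⟩ := exists_card_sums_ge hd hd1
  have hkR : (0 : ℝ) < k := by exact_mod_cast hk
  -- `a exp j / h` is half of the lower bound for the `g`-mass of a good cell `j ≤ 16 h`.
  obtain ⟨a, ha⟩ : ∃ a : ℝ, a = c / (32 * Real.exp 1) := ⟨_, rfl⟩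
  have ha0 : 0 < a := by rw [ha]; positivity
  obtain ⟨H₁, hH₁⟩ : ∃ H₁ : ℕ, ∀ h ≥ H₁, ((k + k : ℕ) : ℝ) * β * h ≤ a * Real.exp h := by
    have ht := (Real.tendsto_exp_div_pow_atTop 1).comp tendsto_natCast_atTop_atTop
    have hev := ht.eventually_ge_atTop (((k + k : ℕ) : ℝ) * β / a)
    obtain ⟨H₁, hH₁⟩ := Filter.eventually_atTop.1 hev
    refine ⟨max 1 H₁, fun h hh ↦ ?_⟩
    have h1 := hH₁ h ((le_max_right _ _).trans hh)
    have hpos : (0 : ℝ) < h := by exact_mod_cast (le_max_left _ _).trans hh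
    simp only [Function.comp, pow_one] at h1
    rw [div_le_div_iff₀ ha0 hpos] at h1
    linarith
  set H₂ := max (max H H₀) (max H₁ 2) with hH₂
  refine ⟨k + k, 1 / (8 * k), by positivity,
    c₂ * a ^ (k + k) * Real.exp (-(k + 1)), by positivity,
    Real.exp (4 * k * (H₂ + 1) + 10 * k + 2), fun X hX ↦ ?_⟩
  have hX0 : 0 < X := (Real.exp_pos _).trans_le hX
  have hlogX : 4 * k * (H₂ + 1) + 10 * k + 2 ≤ Real.log X := (Real.le_log_iff_exp_le hX0).2 hX
  have hH₂0 : (0 : ℝ) ≤ H₂ := Nat.cast_nonneg _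
  have hlogpos : 0 < Real.log X := by
    refine lt_of_lt_of_le ?_ hlogX
    positivity
  set N₀ := ⌊Real.log X⌋₊ with hN₀
  have hN₀1 : (N₀ : ℝ) ≤ Real.log X := Nat.floor_le hlogpos.le
  have hN₀2 : Real.log X < N₀ + 1 := Nat.lt_floor_add_one _
  have hN₀3 : 4 * k * (H₂ + 1) + 10 * k + 2 ≤ N₀ := by
    rw [hN₀, Nat.le_floor_iff hlogpos.le]
    exact_mod_cast hlogX
  set N := N₀ - k with hN
  have hNk : N + k = N₀ := by omega
  set h := N / (4 * k) with hh
  have hh1 : 4 * k * h ≤ N := Nat.mul_div_le _ _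
  have hh2 : N < 4 * k * (h + 1) := Nat.lt_mul_div_succ N (by omega)
  have hhH : H₂ ≤ h := by
    rw [hh, Nat.le_div_iff_mul_le (by omega)]
    nlinarith
  have hhH0 : H ≤ h := (le_max_left H H₀).trans ((le_max_left _ _).trans hhH)
  have hhH0' : H₀ ≤ h := (le_max_right H H₀).trans ((le_max_left _ _).trans hhH)
  have hhH1 : H₁ ≤ h := (le_max_left H₁ 2).trans ((le_max_right _ _).trans hhH)
  have hhH2 : 2 ≤ h := (le_max_right H₁ 2).trans ((le_max_right _ _).trans hhH)
  have hh0 : (0 : ℝ) < h := by exact_mod_cast (by omega : 0 < h)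
  set A := {j ∈ Ioc h (16 * h) | c ≤ ∑ p ∈ primeCell j, g p * Real.log p / p} with hA
  have hAw : ∀ l m : ℕ, h ≤ l → m ≤ 16 * h → A ∩ Ioc l m =
      {j ∈ Ioc l m | c ≤ ∑ p ∈ primeCell j, g p * Real.log p / p} := by
    intro l m hl hm
    ext j
    simp only [hA, mem_inter, mem_filter, mem_Ioc]
    constructor
    · rintro ⟨⟨_, h1⟩, h2⟩; exact ⟨h2, h1⟩
    · rintro ⟨h2, h1⟩; exact ⟨⟨⟨by omega, by omega⟩, h1⟩, h2⟩
  have hW := hH h hhH0 A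
    (by rw [hAw _ _ le_rfl (by omega)]; exact hdens h hhH0')
    (by
      have h1 := hdens (8 * h) (by omega)
      rw [show 2 * (8 * h) = 16 * h by omega] at h1
      rw [hAw _ _ (by omega) le_rfl]
      refine le_trans ?_ h1
      push_cast
      gcongr
      linarith) N hh1
    (by
      have h1 : 4 * k * (h + 1) = 4 * (k * h) + 4 * k := by ring
      have h2 : 7 * k * h = 7 * (k * h) := by ring
      have h3 : k * 2 ≤ k * h := Nat.mul_le_mul_left _ hhH2
      omega)
  set W := {w ∈ (Fintype.piFinset fun _ : Fin k ↦ A) ×ˢ (Fintype.piFinset fun _ : Fin k ↦ A) |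
    ∑ i, w.1 i + ∑ i, w.2 i ∈ Icc N (N + k)} with hWdef
  have hWmem : ∀ w ∈ W, (∀ i, Fin.append w.1 w.2 i ∈ A) ∧
      ∑ i, Fin.append w.1 w.2 i ∈ Icc N N₀ := by
    intro w hw
    rw [hWdef, mem_filter, mem_product, Fintype.mem_piFinset, Fintype.mem_piFinset, hNk] at hw
    refine ⟨fun i ↦ ?_, ?_⟩
    · refine Fin.addCases (fun i ↦ ?_) (fun i ↦ ?_) i
      · rw [Fin.append_left]; exact hw.1.1 i
      · rw [Fin.append_right]; exact hw.1.2 i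
    · rw [Fin.sum_univ_add]
      simpa only [Fin.append_left, Fin.append_right] using hw.2
  set T : (Fin k → ℕ) × (Fin k → ℕ) → Finset (Fin (k + k) → ℕ) := fun w ↦
    {f ∈ Fintype.piFinset fun i ↦ primeCell (Fin.append w.1 w.2 i) |
      Function.Injective f ∧ ∀ i, f i ∉ (∅ : Finset ℕ)} with hT
  have hTmem : ∀ w, ∀ f ∈ T w, (∀ i, f i ∈ primeCell (Fin.append w.1 w.2 i)) ∧
      Function.Injective f := fun w f hf ↦ by
    rw [hT, mem_filter, Fintype.mem_piFinset] at hf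
    exact ⟨hf.1, hf.2.1⟩
  have hAmem : ∀ j ∈ A, h < j ∧ j ≤ 16 * h ∧
      c ≤ ∑ p ∈ primeCell j, g p * Real.log p / p := fun j hj ↦ by
    rw [hA, mem_filter, mem_Ioc] at hj
    exact ⟨hj.1.1, hj.1.2, hj.2⟩
  refine ⟨W.biUnion T, fun f hf ↦ ?_, ?_⟩
  · rw [mem_biUnion] at hf
    obtain ⟨w, hw, hf⟩ := hf
    obtain ⟨hwA, hwN⟩ := hWmem w hw
    obtain ⟨hfc, hfi⟩ := hTmem w f hf
    refine ⟨fun i ↦ ⟨(mem_primeCell.1 (hfc i)).1, ?_⟩, hfi, ?_⟩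
    · refine lt_of_le_of_lt ?_ (mem_primeCell.1 (hfc i)).2.1
      rw [Real.rpow_def_of_pos hX0, Real.exp_le_exp, mul_one_div, div_le_iff₀ (by positivity)]
      have h1 : ((h + 1 : ℕ) : ℝ) ≤ Fin.append w.1 w.2 i := by
        exact_mod_cast (hAmem _ (hwA i)).1
      have h2 : (N₀ : ℝ) ≤ 4 * k * (h + 1) + k := by
        exact_mod_cast (by omega : N₀ ≤ 4 * k * (h + 1) + k)
      push_cast at h1
      have h3 : (h : ℝ) * (8 * k) ≤ (Fin.append w.1 w.2 i - 1) * (8 * k) := by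
        gcongr; linarith
      refine le_trans ?_ h3
      have h4 : 0 ≤ (k : ℝ) * H₂ := by positivity
      nlinarith
    · rw [mem_Icc] at hwN
      calc ∏ i, (f i : ℝ) ≤ ∏ i, Real.exp ((Fin.append w.1 w.2 i : ℕ) : ℝ) :=
            prod_le_prod (fun _ _ ↦ Nat.cast_nonneg _) fun i _ ↦ (mem_primeCell.1 (hfc i)).2.2
        _ = Real.exp ((∑ i, Fin.append w.1 w.2 i : ℕ) : ℝ) := by
            rw [← Real.exp_sum]; push_cast; rfl
        _ ≤ Real.exp (Real.log X) := by
            rw [Real.exp_le_exp]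
            exact le_trans (by exact_mod_cast hwN.2) hN₀1
        _ = X := Real.exp_log hX0
  · have hdisj : (W : Set _).PairwiseDisjoint T := by
      intro w _ w' _ hww'
      refine disjoint_left.2 fun f hf hf' ↦ hww' ?_
      have h1 : Fin.append w.1 w.2 = Fin.append w'.1 w'.2 := funext fun i ↦
        eq_of_mem_primeCell ((hTmem w f hf).1 i) ((hTmem w' f hf').1 i)
      refine Prod.ext (funext fun i ↦ ?_) (funext fun i ↦ ?_)
      · simpa only [Fin.append_left] using congrFun h1 (Fin.castAdd k i)
      · simpa only [Fin.append_right] using congrFun h1 (Fin.natAdd k i)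
    rw [sum_biUnion hdisj]
    have hterm : ∀ w ∈ W, (a / h) ^ (k + k) * Real.exp N ≤ ∑ f ∈ T w, ∏ i, g (f i) := by
      intro w hw
      obtain ⟨hwA, hwN⟩ := hWmem w hw
      have h1 := prod_le_sum_injective hg hβ.le (k + k) (fun i ↦ primeCell (Fin.append w.1 w.2 i))
        (fun i p hp ↦ hgβ p (mem_primeCell.1 hp).1)
        (fun i ↦ a / h * Real.exp ((Fin.append w.1 w.2 i : ℕ) : ℝ)) (fun i ↦ by positivity) ∅
        (fun i ↦ by
          obtain ⟨a1, a2, a3⟩ := hAmem _ (hwA i)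
          generalize Fin.append w.1 w.2 i = j at *
          have b1 := sum_primeCell_ge hg a3
          have b2 : ((j : ℕ) : ℝ) * ∑ p ∈ primeCell j, g p ≤ 16 * h * ∑ p ∈ primeCell j, g p := by
            refine mul_le_mul_of_nonneg_right (by exact_mod_cast a2) (sum_nonneg fun _ _ ↦ hg _)
          have b3 := hH₁ h hhH1
          have b4 : Real.exp h ≤ Real.exp j := by
            rw [Real.exp_le_exp]; exact_mod_cast a1.le
          have b5 : c * Real.exp (j - 1) = 32 * (a * Real.exp j) := by
            rw [Real.exp_sub, ha]; field_simp
          rw [b5] at b1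
          have b6 : a * Real.exp h ≤ a * Real.exp j := by gcongr
          refine le_of_mul_le_mul_left ?_ hh0
          rw [mul_add, ← mul_assoc, mul_div_cancel₀ _ hh0.ne']
          simp only [card_empty, Nat.cast_zero, zero_add]
          linarith)
      rw [prod_mul_distrib, prod_const, card_univ, Fintype.card_fin, ← Real.exp_sum] at h1
      refine le_trans ?_ h1
      gcongr
      rw [mem_Icc] at hwN
      exact_mod_cast hwN.1
    refine le_trans ?_ (sum_le_sum hterm)
    rw [sum_const, nsmul_eq_mul]
    have hXN : X * Real.exp (-(k + 1)) ≤ Real.exp N := by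
      conv_lhs => rw [← Real.exp_log hX0]
      rw [← Real.exp_add, Real.exp_le_exp]
      have : (N : ℝ) + k = N₀ := by exact_mod_cast hNk
      linarith
    have hhlog : (h : ℝ) ≤ Real.log X := by
      refine le_trans ?_ hN₀1
      exact_mod_cast (by nlinarith : h ≤ N₀)
    calc c₂ * a ^ (k + k) * Real.exp (-(k + 1)) * X / Real.log X
        ≤ c₂ * a ^ (k + k) * Real.exp (-(k + 1)) * X / h := by gcongr
      _ = c₂ * a ^ (k + k) / h * (X * Real.exp (-(k + 1))) := by ring
      _ ≤ c₂ * a ^ (k + k) / h * Real.exp N := by gcongr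
      _ = (c₂ * (h : ℝ) ^ (2 * k - 1)) * ((a / h) ^ (k + k) * Real.exp N) := by
        have : (h : ℝ) ^ (k + k) = h ^ (2 * k - 1) * h := by
          rw [← pow_succ]; congr 1; omega
        rw [div_pow, this]
        field_simp
      _ ≤ _ := by gcongr

/-! ### Combining smooth numbers with large primes -/

lemma sum_powerset_prod_mul_sum_le {ι : Type*} [DecidableEq ι] (s : Finset ι) (u l : ι → ℝ)
    (hu : ∀ i, 0 ≤ u i) (hl : ∀ i, 0 ≤ l i) :
    ∑ T ∈ s.powerset, (∏ i ∈ T, u i) * ∑ i ∈ T, l i ≤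
      (∑ i ∈ s, u i * l i) * ∏ i ∈ s, (1 + u i) := by
  induction s using Finset.induction_on with
  | empty => simp
  | insert a s ha ih =>
    have hT : ∀ T ∈ s.powerset, (∏ i ∈ insert a T, u i) * ∑ i ∈ insert a T, l i =
        u a * ((∏ i ∈ T, u i) * ∑ i ∈ T, l i) + u a * l a * ∏ i ∈ T, u i := by
      intro T hT
      have haT : a ∉ T := fun h ↦ ha (mem_powerset.1 hT h)
      rw [prod_insert haT, sum_insert haT]
      ring
    rw [sum_powerset_insert ha, sum_congr rfl hT, sum_add_distrib, ← mul_sum, ← mul_sum,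
      ← prod_one_add, sum_insert ha, prod_insert ha]
    have hP : 0 ≤ ∏ i ∈ s, (1 + u i) := prod_nonneg fun i _ ↦ by linarith [hu i]
    have h1 := mul_le_mul_of_nonneg_left ih (by linarith [hu a] : 0 ≤ 1 + u a)
    have h2 : 0 ≤ u a * (u a * l a * ∏ i ∈ s, (1 + u i)) :=
      mul_nonneg (hu a) (mul_nonneg (mul_nonneg (hu a) (hl a)) hP)
    nlinarith

/-- Markov's inequality for the logarithm of a random squarefree number: most of the Euler product
`∏ (1 + u p)` comes from subsets with small sum of logarithms. -/
lemma half_prod_one_add_le {ι : Type*} [DecidableEq ι] (s : Finset ι) (u l : ι → ℝ)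
    (hu : ∀ i, 0 ≤ u i) (hl : ∀ i, 0 ≤ l i) {M : ℝ} (hM : 0 < M)
    (h : ∑ i ∈ s, u i * l i ≤ M / 2) :
    (∏ i ∈ s, (1 + u i)) / 2 ≤ ∑ T ∈ s.powerset with ∑ i ∈ T, l i ≤ M, ∏ i ∈ T, u i := by
  have hP : 0 ≤ ∏ i ∈ s, (1 + u i) := prod_nonneg fun i _ ↦ by linarith [hu i]
  have hu' : ∀ T : Finset ι, 0 ≤ ∏ i ∈ T, u i := fun T ↦ prod_nonneg fun i _ ↦ hu i
  have h1 := sum_powerset_prod_mul_sum_le s u l hu hl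
  have h2 : M * ∑ T ∈ s.powerset with ¬ ∑ i ∈ T, l i ≤ M, ∏ i ∈ T, u i ≤
      ∑ T ∈ s.powerset, (∏ i ∈ T, u i) * ∑ i ∈ T, l i := by
    rw [mul_sum]
    refine (sum_le_sum fun T hT ↦ ?_).trans (sum_le_sum_of_subset_of_nonneg (filter_subset _ _)
      fun T _ _ ↦ mul_nonneg (hu' T) (sum_nonneg fun i _ ↦ hl i))
    rw [mul_comm]
    exact mul_le_mul_of_nonneg_left (not_le.1 (mem_filter.1 hT).2).le (hu' T)
  have h3 : (∑ i ∈ s, u i * l i) * ∏ i ∈ s, (1 + u i) ≤ M / 2 * ∏ i ∈ s, (1 + u i) := by gcongr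
  have h4 := sum_filter_add_sum_filter_not s.powerset (fun T ↦ ∑ i ∈ T, l i ≤ M)
    fun T ↦ ∏ i ∈ T, u i
  rw [← prod_one_add] at h4
  have h5 : ∑ T ∈ s.powerset with ¬ ∑ i ∈ T, l i ≤ M, ∏ i ∈ T, u i ≤
      (∏ i ∈ s, (1 + u i)) / 2 := by
    refine le_of_mul_le_mul_left ?_ hM
    linarith
  linarith

/-- Passing from `x ^ δ` to `x` in the Euler product costs only a constant factor. -/
lemma prod_one_add_le_exp_mul {g : ℕ → ℝ} (hg : ∀ n, 0 ≤ g n) {β : ℝ} (hβ : 0 < β)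
    (hgβ : ∀ p : ℕ, p.Prime → g p ≤ β) {C x y δ : ℝ} (hδ : 0 < δ) (hx : 1 < x)
    (hy : Real.log y = δ * Real.log x) (hy0 : 0 < y)
    (hC : ∑ p ∈ (Icc 1 ⌊x⌋₊).filter Nat.Prime, Real.log p / p ≤ C * Real.log x) :
    ∏ p ∈ (Icc 1 ⌊x⌋₊).filter Nat.Prime, (1 + g p / p) ≤
      Real.exp (β * C / δ) * ∏ p ∈ (Icc 1 ⌊y⌋₊).filter Nat.Prime, (1 + g p / p) := by
  have hlx : 0 < Real.log x := Real.log_pos hx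
  set s := (Icc 1 ⌊x⌋₊).filter Nat.Prime with hs
  have hgp : ∀ p : ℕ, 0 ≤ g p / p := fun p ↦ div_nonneg (hg p) (Nat.cast_nonneg p)
  rw [← prod_filter_mul_prod_filter_not s (fun p ↦ p ≤ ⌊y⌋₊), mul_comm]
  refine mul_le_mul ?_ ?_ (prod_nonneg fun p _ ↦ by linarith [hgp p]) (Real.exp_pos _).le
  · calc ∏ p ∈ s with ¬ p ≤ ⌊y⌋₊, (1 + g p / p)
        ≤ ∏ p ∈ s with ¬ p ≤ ⌊y⌋₊, Real.exp (g p / p) :=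
          prod_le_prod (fun p _ ↦ by linarith [hgp p]) fun p _ ↦ by
            rw [add_comm]; exact Real.add_one_le_exp _
      _ = Real.exp (∑ p ∈ s with ¬ p ≤ ⌊y⌋₊, g p / p) := (Real.exp_sum _ _).symm
      _ ≤ _ := by
        rw [Real.exp_le_exp]
        calc ∑ p ∈ s with ¬ p ≤ ⌊y⌋₊, g p / p
            ≤ ∑ p ∈ s with ¬ p ≤ ⌊y⌋₊, β / (δ * Real.log x) * (Real.log p / p) := by
              refine sum_le_sum fun p hp ↦ ?_
              rw [mem_filter, hs, mem_filter, not_le, Nat.floor_lt hy0.le] at hp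
              have hlog : δ * Real.log x ≤ Real.log p := by
                rw [← hy]; exact Real.log_le_log hy0 hp.2.le
              rw [div_mul_div_comm]
              have hp0 : (0 : ℝ) < p := by exact_mod_cast hp.1.2.pos
              rw [div_le_div_iff₀ hp0 (by positivity)]
              calc g p * (δ * Real.log x * p) ≤ β * (Real.log p * p) := by
                    gcongr
                    exact hgβ p hp.1.2
                _ = _ := by ring
          _ ≤ ∑ p ∈ s, β / (δ * Real.log x) * (Real.log p / p) :=
              sum_le_sum_of_subset_of_nonneg (filter_subset _ _) fun p _ _ ↦
                mul_nonneg (by positivity)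
                  (div_nonneg (Real.log_natCast_nonneg p) (Nat.cast_nonneg p))
          _ ≤ β / (δ * Real.log x) * (C * Real.log x) := by
              rw [← mul_sum]; gcongr
          _ = β * C / δ := by field_simp
  · refine prod_le_prod_of_subset_of_one_le (fun p hp ↦ ?_) (fun p _ ↦ by linarith [hgp p])
      fun p _ _ ↦ by linarith [hgp p]
    rw [mem_filter, hs, mem_filter, mem_Icc] at hp
    rw [mem_filter, mem_Icc]
    exact ⟨⟨hp.1.1.1, hp.2⟩, hp.1.2⟩

/-- An integer has boundedly many prime factors exceeding a fixed power of it. -/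
lemma card_large_primeFactors_le {n : ℕ} (hn : 0 < n) {x δ : ℝ} (hx : 1 < x)
    (hnx : (n : ℝ) ≤ x) (hδ : 0 < δ) : (#{p ∈ n.primeFactors | x ^ δ < (p : ℕ)} : ℝ) ≤ 1 / δ := by
  have hx0 : 0 < x := by linarith
  set S := {p ∈ n.primeFactors | x ^ δ < (p : ℕ)} with hS
  have h1 : (x ^ δ) ^ #S ≤ x := by
    calc (x ^ δ) ^ #S = ∏ p ∈ S, x ^ δ := by simp
      _ ≤ ∏ p ∈ S, (p : ℝ) := prod_le_prod (fun _ _ ↦ by positivity) fun p hp ↦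
          (mem_filter.1 hp).2.le
      _ = ((∏ p ∈ S, p : ℕ) : ℝ) := by push_cast; rfl
      _ ≤ n := by
          exact_mod_cast Nat.le_of_dvd hn ((prod_dvd_prod_of_subset _ _ _
            (filter_subset _ _)).trans (Nat.prod_primeFactors_dvd n))
      _ ≤ x := hnx
  rw [← Real.rpow_natCast, ← Real.rpow_mul hx0.le] at h1
  have h2 : δ * #S ≤ 1 := by
    by_contra! h
    have := Real.rpow_lt_rpow_of_exponent_lt hx h
    rw [Real.rpow_one] at this
    linarith
  rw [le_div_iff₀ hδ]
  linarith

/-- Products of a squarefree `x ^ δ`-smooth number and `r` larger primes represent each integer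
boundedly often, so their total `g`-weight bounds the summatory function of `g`. -/
lemma sum_sum_prod_le {g : ArithmeticFunction ℝ} (hmul : g.IsMultiplicative)
    (hg : ∀ n, 0 ≤ g n) {x δ : ℝ} (hx : 1 < x) (hδ : 0 < δ) {r : ℕ} (S : Finset (Finset ℕ))
    (F : Finset ℕ → Finset (Fin r → ℕ))
    (hS : ∀ T ∈ S, ∀ p ∈ T, p.Prime ∧ (p : ℝ) ≤ x ^ δ)
    (hF : ∀ T ∈ S, ∀ f ∈ F T, (∀ i, (f i).Prime ∧ x ^ δ < f i) ∧ Function.Injective f ∧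
      (∏ p ∈ T, (p : ℝ)) * ∏ i, (f i : ℝ) ≤ x) :
    ∑ T ∈ S, (∏ p ∈ T, g p) * ∑ f ∈ F T, ∏ i, g (f i) ≤
      (1 / δ) ^ r * ∑ n ∈ Icc 1 ⌊x⌋₊, g n := by
  have hx0 : 0 < x := by linarith
  set Φ : (_ : Finset ℕ) × (Fin r → ℕ) → ℕ := fun w ↦ (∏ p ∈ w.1, p) * ∏ i, w.2 i with hΦ
  set U : (_ : Finset ℕ) × (Fin r → ℕ) → Finset ℕ := fun w ↦ w.1 ∪ univ.image w.2 with hU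
  have hprop : ∀ w ∈ S.sigma F, (∀ p ∈ U w, p.Prime) ∧ Disjoint w.1 (univ.image w.2) ∧
      Function.Injective w.2 := by
    rintro ⟨T, f⟩ hw
    rw [mem_sigma] at hw
    obtain ⟨h1, h2, h3⟩ := hF T hw.1 f hw.2
    refine ⟨fun p hp ↦ ?_, disjoint_left.2 fun p hp hp' ↦ ?_, h2⟩
    · rcases mem_union.1 hp with hp | hp
      · exact (hS T hw.1 p hp).1
      · obtain ⟨i, _, rfl⟩ := mem_image.1 hp
        exact (h1 i).1
    · obtain ⟨i, _, rfl⟩ := mem_image.1 hp'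
      exact absurd (hS T hw.1 _ hp).2 (not_le.2 (h1 i).2)
  have hΦU : ∀ w ∈ S.sigma F, Φ w = ∏ p ∈ U w, p := fun w hw ↦ by
    obtain ⟨_, h2, h3⟩ := hprop w hw
    rw [hU, hΦ, prod_union h2, prod_image h3.injOn]
  have hgΦ : ∀ w ∈ S.sigma F, g (Φ w) = (∏ p ∈ w.1, g p) * ∏ i, g (w.2 i) := fun w hw ↦ by
    obtain ⟨h1, h2, h3⟩ := hprop w hw
    rw [hΦU w hw, hmul.map_prod_of_prime _ h1, hU, prod_union h2, prod_image h3.injOn]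
  have hΦmem : ∀ w ∈ S.sigma F, Φ w ∈ Icc 1 ⌊x⌋₊ := fun w hw ↦ by
    rw [mem_Icc, Nat.le_floor_iff hx0.le]
    constructor
    · rw [hΦU w hw]
      exact prod_pos fun p hp ↦ ((hprop w hw).1 p hp).pos
    · rw [mem_sigma] at hw
      have := (hF _ hw.1 _ hw.2).2.2
      rw [hΦ]
      push_cast
      exact this
  have hΦpf : ∀ w ∈ S.sigma F, (Φ w).primeFactors = U w := fun w hw ↦ by
    rw [hΦU w hw, Nat.primeFactors_prod (hprop w hw).1]
  have hfib : ∀ n ∈ Icc 1 ⌊x⌋₊, (#{w ∈ S.sigma F | Φ w = n} : ℝ) ≤ (1 / δ) ^ r := by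
    intro n hn
    rw [mem_Icc, Nat.le_floor_iff hx0.le] at hn
    calc (#{w ∈ S.sigma F | Φ w = n} : ℝ)
        ≤ #(Fintype.piFinset fun _ : Fin r ↦ {p ∈ n.primeFactors | x ^ δ < (p : ℕ)}) := by
          norm_cast
          refine card_le_card_of_injOn (fun w ↦ w.2) ?_ ?_
          · intro w hw
            rw [mem_coe, mem_filter] at hw
            rw [mem_coe, Fintype.mem_piFinset]
            intro i
            rw [mem_filter, ← hw.2, hΦpf w hw.1, hU]
            have hw' := mem_sigma.1 hw.1
            exact ⟨mem_union_right _ (mem_image_of_mem _ (mem_univ i)),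
              ((hF _ hw'.1 _ hw'.2).1 i).2⟩
          · have hfst : ∀ w ∈ S.sigma F, Φ w = n →
                w.1 = {p ∈ n.primeFactors | ((p : ℕ) : ℝ) ≤ x ^ δ} := by
              intro w hw hwn
              have hw' := mem_sigma.1 hw
              rw [← hwn, hΦpf w hw, hU]
              ext p
              rw [mem_filter, mem_union]
              constructor
              · intro hp
                exact ⟨Or.inl hp, (hS _ hw'.1 p hp).2⟩
              · rintro ⟨hp | hp, hpx⟩
                · exact hp
                · obtain ⟨i, _, rfl⟩ := mem_image.1 hp
                  exact absurd hpx (not_le.2 ((hF _ hw'.1 _ hw'.2).1 i).2)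
            rintro ⟨T, f⟩ hw ⟨T', f'⟩ hw' hff'
            rw [mem_coe, mem_filter] at hw hw'
            have h1 := hfst _ hw.1 hw.2
            have h2 := hfst _ hw'.1 hw'.2
            simp only at h1 h2 hff'
            rw [h1, h2, hff']
      _ = (#{p ∈ n.primeFactors | x ^ δ < (p : ℕ)} : ℝ) ^ r := by
          rw [Fintype.card_piFinset_const]; push_cast; rfl
      _ ≤ (1 / δ) ^ r := by
          gcongr
          exact card_large_primeFactors_le hn.1 hx hn.2 hδ
  calc ∑ T ∈ S, (∏ p ∈ T, g p) * ∑ f ∈ F T, ∏ i, g (f i)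
      = ∑ w ∈ S.sigma F, g (Φ w) := by
        rw [sum_congr rfl hgΦ, sum_sigma]
        exact sum_congr rfl fun T _ ↦ mul_sum _ _ _
    _ = ∑ n ∈ Icc 1 ⌊x⌋₊, ∑ w ∈ S.sigma F with Φ w = n, g (Φ w) :=
        (sum_fiberwise_of_maps_to hΦmem _).symm
    _ = ∑ n ∈ Icc 1 ⌊x⌋₊, #{w ∈ S.sigma F | Φ w = n} * g n := by
        refine sum_congr rfl fun n _ ↦ ?_
        rw [← nsmul_eq_mul, ← sum_const]
        exact sum_congr rfl fun w hw ↦ by rw [(mem_filter.1 hw).2]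
    _ ≤ ∑ n ∈ Icc 1 ⌊x⌋₊, (1 / δ) ^ r * g n :=
        sum_le_sum fun n hn ↦ mul_le_mul_of_nonneg_right (hfib n hn) (hg n)
    _ = _ := (mul_sum _ _ _).symm

/-- Once the large prime factors are available, the lower bound holds for all large `x`. -/
theorem exists_forall_ge_le_sum {g : ArithmeticFunction ℝ} (hmul : g.IsMultiplicative)
    (hg : ∀ n, 0 ≤ g n) {β : ℝ} (hβ : 0 < β) (hgβ : ∀ p : ℕ, p.Prime → g p ≤ β)
    {r : ℕ} {δ : ℝ} (hδ : 0 < δ) {c₁ : ℝ} (hc₁ : 0 < c₁) {X₀ : ℝ}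
    (hlarge : ∀ X ≥ X₀, ∃ F : Finset (Fin r → ℕ),
        (∀ f ∈ F, (∀ i, (f i).Prime ∧ X ^ δ < f i) ∧ Function.Injective f ∧
          ∏ i, (f i : ℝ) ≤ X) ∧
        c₁ * X / Real.log X ≤ ∑ f ∈ F, ∏ i, g (f i)) :
    ∃ c₀ : ℝ, 0 < c₀ ∧ ∃ x₀ : ℝ, ∀ x ≥ x₀,
      c₀ * x / Real.log x * ∏ p ∈ (Icc 1 ⌊x⌋₊).filter Nat.Prime, (1 + g p / (p : ℝ)) ≤
        ∑ n ∈ Icc 1 ⌊x⌋₊, g n := by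
  obtain ⟨C, hC, hMert⟩ := exists_sum_log_div_le
  -- `η ≤ δ / 2` makes `x ^ η ≤ X ^ δ` for `X ≥ √x`; the other bound feeds Markov's inequality.
  set η : ℝ := min (δ / 2) (1 / (4 * β * C)) with hη
  have hη0 : 0 < η := by positivity
  have hη1 : η ≤ δ / 2 := min_le_left _ _
  have hη2 : β * C * η ≤ 1 / 4 := by
    have : η ≤ 1 / (4 * β * C) := min_le_right _ _
    calc β * C * η ≤ β * C * (1 / (4 * β * C)) := by gcongr
      _ = 1 / 4 := by field_simp
  refine ⟨η ^ r * (c₁ / 2) * Real.exp (-(β * C / η)), by positivity,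
    max (max 2 (2 ^ (1 / η))) (X₀ ^ 2), fun x hx ↦ ?_⟩
  have hx2 : 2 ≤ x := (le_max_left _ _).trans ((le_max_left _ _).trans hx)
  have hxη : (2 : ℝ) ^ (1 / η) ≤ x := (le_max_right _ _).trans ((le_max_left _ _).trans hx)
  have hxX : X₀ ^ 2 ≤ x := (le_max_right _ _).trans hx
  have hx0 : 0 < x := by linarith
  have hlx : 0 < Real.log x := Real.log_pos (by linarith)
  have hy2 : 2 ≤ x ^ η := by
    calc (2 : ℝ) = ((2 : ℝ) ^ (1 / η)) ^ η := by
          rw [← Real.rpow_mul two_pos.le, one_div_mul_cancel hη0.ne', Real.rpow_one]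
      _ ≤ x ^ η := by gcongr
  have hly : Real.log (x ^ η) = η * Real.log x := Real.log_rpow hx0 _
  set u : ℕ → ℝ := fun p ↦ g p / p with hu
  have hu0 : ∀ p, 0 ≤ u p := fun p ↦ div_nonneg (hg p) (Nat.cast_nonneg p)
  set s := (Icc 1 ⌊x ^ η⌋₊).filter Nat.Prime with hs
  have hsmem : ∀ p ∈ s, p.Prime ∧ (p : ℝ) ≤ x ^ η := fun p hp ↦ by
    rw [hs, mem_filter, mem_Icc, Nat.le_floor_iff (by linarith)] at hp
    exact ⟨hp.2, hp.1.2⟩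
  have hMarkov : (∏ p ∈ s, (1 + u p)) / 2 ≤
      ∑ T ∈ s.powerset with ∑ p ∈ T, Real.log (p : ℕ) ≤ Real.log x / 2, ∏ p ∈ T, u p := by
    refine half_prod_one_add_le s u (fun p ↦ Real.log p) hu0 Real.log_natCast_nonneg
      (by positivity) ?_
    calc ∑ p ∈ s, u p * Real.log p ≤ ∑ p ∈ s, β * (Real.log p / p) := by
          refine sum_le_sum fun p hp ↦ ?_
          rw [hu, div_mul_eq_mul_div, mul_div_assoc]
          exact mul_le_mul_of_nonneg_right (hgβ p (hsmem p hp).1)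
            (div_nonneg (Real.log_natCast_nonneg p) (Nat.cast_nonneg p))
      _ ≤ β * (C * (η * Real.log x)) := by
          rw [← mul_sum, ← hly]
          gcongr
          exact hMert _ hy2
      _ = β * C * η * Real.log x := by ring
      _ ≤ 1 / 4 * Real.log x := by gcongr
      _ = _ := by ring
  set S := {T ∈ s.powerset | ∑ p ∈ T, Real.log (p : ℕ) ≤ Real.log x / 2} with hSdef
  have hSprime : ∀ T ∈ S, ∀ p ∈ T, p.Prime ∧ (p : ℝ) ≤ x ^ η := fun T hT p hp ↦
    hsmem p (mem_powerset.1 (mem_filter.1 hT).1 hp)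
  have hSpos : ∀ T ∈ S, 1 ≤ ∏ p ∈ T, (p : ℝ) := fun T hT ↦
    one_le_prod fun p hp ↦ by exact_mod_cast (hSprime T hT p hp).1.one_le
  have hSsq : ∀ T ∈ S, √x ≤ x / ∏ p ∈ T, (p : ℝ) := fun T hT ↦ by
    have hpos := hSpos T hT
    rw [le_div_iff₀ (by linarith)]
    have h1 : Real.log (∏ p ∈ T, (p : ℝ)) ≤ Real.log (√x) := by
      rw [Real.log_prod fun p hp ↦ by
        exact_mod_cast (hSprime T hT p hp).1.ne_zero, Real.log_sqrt hx0.le]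
      exact (mem_filter.1 hT).2
    have h2 : ∏ p ∈ T, (p : ℝ) ≤ √x :=
      (Real.log_le_log_iff (by linarith) (Real.sqrt_pos.2 hx0)).1 h1
    calc √x * ∏ p ∈ T, (p : ℝ) ≤ √x * √x := by gcongr
      _ = x := Real.mul_self_sqrt hx0.le
  have hX₀sq : X₀ ≤ √x := Real.le_sqrt_of_sq_le hxX
  have hsq1 : 1 < √x := by rw [Real.lt_sqrt zero_le_one]; linarith
  have hlarge' : ∀ T ∈ S, ∃ F : Finset (Fin r → ℕ),
      (∀ f ∈ F, (∀ i, (f i).Prime ∧ x ^ η < f i) ∧ Function.Injective f ∧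
        (∏ p ∈ T, (p : ℝ)) * ∏ i, (f i : ℝ) ≤ x) ∧
      c₁ * (x / ∏ p ∈ T, (p : ℝ)) / Real.log x ≤ ∑ f ∈ F, ∏ i, g (f i) := by
    intro T hT
    have hpos := hSpos T hT
    have hsq := hSsq T hT
    obtain ⟨F, hF1, hF2⟩ := hlarge (x / ∏ p ∈ T, (p : ℝ)) (hX₀sq.trans hsq)
    refine ⟨F, fun f hf ↦ ?_, le_trans ?_ hF2⟩
    · obtain ⟨h1, h2, h3⟩ := hF1 f hf
      refine ⟨fun i ↦ ⟨(h1 i).1, lt_of_le_of_lt ?_ (h1 i).2⟩, h2, ?_⟩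
      · calc x ^ η ≤ x ^ (δ / 2) := Real.rpow_le_rpow_of_exponent_le (by linarith) hη1
          _ = (√x) ^ δ := by
            rw [Real.sqrt_eq_rpow, ← Real.rpow_mul hx0.le]; ring_nf
          _ ≤ _ := Real.rpow_le_rpow (Real.sqrt_nonneg x) hsq hδ.le
      · rw [le_div_iff₀ (by linarith)] at h3
        linarith
    · have hX1 : 1 < x / ∏ p ∈ T, (p : ℝ) := hsq1.trans_le hsq
      refine div_le_div_of_nonneg_left (by positivity) (Real.log_pos hX1) ?_
      exact Real.log_le_log (by linarith) (div_le_self hx0.le hpos)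
  choose! F hF1 hF2 using hlarge'
  have hup := sum_sum_prod_le hmul hg (by linarith : 1 < x) hη0 S F hSprime hF1
  have hlow : c₁ * x / Real.log x * ((∏ p ∈ s, (1 + u p)) / 2) ≤
      ∑ T ∈ S, (∏ p ∈ T, g p) * ∑ f ∈ F T, ∏ i, g (f i) := by
    calc c₁ * x / Real.log x * ((∏ p ∈ s, (1 + u p)) / 2)
        ≤ c₁ * x / Real.log x * ∑ T ∈ S, ∏ p ∈ T, u p := by gcongr
      _ = ∑ T ∈ S, (∏ p ∈ T, g p) * (c₁ * (x / ∏ p ∈ T, (p : ℝ)) / Real.log x) := by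
          rw [mul_sum]
          refine sum_congr rfl fun T _ ↦ ?_
          rw [hu, prod_div_distrib]
          ring
      _ ≤ _ := sum_le_sum fun T hT ↦
          mul_le_mul_of_nonneg_left (hF2 T hT) (prod_nonneg fun p _ ↦ hg p)
  have hEuler := prod_one_add_le_exp_mul hg hβ hgβ hη0 (by linarith : 1 < x) hly (by linarith)
    (hMert x hx2)
  have hηr : η ^ r * (1 / η) ^ r = 1 := by
    rw [← mul_pow, mul_one_div_cancel hη0.ne', one_pow]
  calc η ^ r * (c₁ / 2) * Real.exp (-(β * C / η)) * x / Real.log x *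
        ∏ p ∈ (Icc 1 ⌊x⌋₊).filter Nat.Prime, (1 + g p / (p : ℝ))
      ≤ η ^ r * (c₁ / 2) * Real.exp (-(β * C / η)) * x / Real.log x *
        (Real.exp (β * C / η) * ∏ p ∈ s, (1 + u p)) := by gcongr
    _ = η ^ r * (c₁ * x / Real.log x * ((∏ p ∈ s, (1 + u p)) / 2)) := by
        rw [Real.exp_neg]
        field_simp
    _ ≤ η ^ r * ((1 / η) ^ r * ∑ n ∈ Icc 1 ⌊x⌋₊, g n) := by
        exact mul_le_mul_of_nonneg_left (hlow.trans hup) (by positivity)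
    _ = ∑ n ∈ Icc 1 ⌊x⌋₊, g n := by rw [← mul_assoc, hηr, one_mul]

theorem theorem2
    (g : ArithmeticFunction ℝ) (hmul : g.IsMultiplicative)
    (hnonneg : ∀ n : ℕ, 0 ≤ g n)
    (hbdd : ∃ β : ℝ, ∀ p : ℕ, p.Prime → g p ≤ β)
    (c : ℝ) (hc : 0 < c)
    (hlow : ∀ b : ℝ, 0 < b → b < 1 →
      (c : EReal) ≤ Filter.liminf
        (fun x : ℝ =>
          ((((1 - b) * Real.log x)⁻¹ *
            ∑ p ∈ (Finset.Icc 1 ⌊x⌋₊).filter (fun p : ℕ => p.Prime ∧ x ^ b < (p : ℝ)),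
              g p * Real.log (p : ℝ) / (p : ℝ) : ℝ) : EReal))
        Filter.atTop) :
    ∃ c₀ : ℝ, 0 < c₀ ∧ ∀ x : ℝ, 2 ≤ x →
      c₀ * x / Real.log x *
          ∏ p ∈ (Finset.Icc 1 ⌊x⌋₊).filter Nat.Prime, (1 + g p / (p : ℝ)) ≤
        ∑ n ∈ Finset.Icc 1 ⌊x⌋₊, g n := by
  obtain ⟨β', hβ'⟩ := hbdd
  obtain ⟨β, hβ, hgβ⟩ : ∃ β : ℝ, 0 < β ∧ ∀ p : ℕ, p.Prime → g p ≤ β :=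
    ⟨max 1 β', by positivity, fun p hp ↦ (hβ' p hp).trans (le_max_right _ _)⟩
  obtain ⟨d, hd, hd1, H, hdens⟩ := exists_card_filter_primeCell_ge hnonneg hβ hgβ hc
    (hlow (1 / 2) (by norm_num) (by norm_num))
  obtain ⟨r, δ, hδ, c₁, hc₁, X₀, hX₀⟩ := exists_sum_prod_large_primes_ge hnonneg hβ hgβ
    (by positivity : 0 < c / 4) hd hd1 hdens
  obtain ⟨c₂, hc₂, x₀, hx₀⟩ := exists_forall_ge_le_sum hmul hnonneg hβ hgβ hδ hc₁ hX₀
  have hfac : ∀ p : ℕ, 1 ≤ 1 + g p / (p : ℝ) := fun p ↦ by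
    have := div_nonneg (hnonneg p) (Nat.cast_nonneg (α := ℝ) p)
    linarith
  -- For `x ≤ x₀` the term `g 1 = 1` alone suffices, the right-hand factor being bounded.
  set P := ∏ p ∈ (Icc 1 ⌊max x₀ 2⌋₊).filter Nat.Prime, (1 + g p / (p : ℝ)) with hP
  have hP1 : 1 ≤ P := one_le_prod fun p _ ↦ hfac p
  have hl2 : 0 < Real.log 2 := Real.log_pos (by norm_num)
  refine ⟨min c₂ (Real.log 2 / (max x₀ 2 * P)), by positivity, fun x hx ↦ ?_⟩
  have hlx : Real.log 2 ≤ Real.log x := Real.log_le_log two_pos hx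
  rcases le_or_gt x₀ x with h | h
  · refine le_trans ?_ (hx₀ x h)
    have h1 : 0 ≤ ∏ p ∈ (Finset.Icc 1 ⌊x⌋₊).filter Nat.Prime, (1 + g p / (p : ℝ)) :=
      prod_nonneg fun p _ ↦ zero_le_one.trans (hfac p)
    have h2 : 0 < Real.log x := by linarith
    gcongr
    exact min_le_left _ _
  · have h1 : ∏ p ∈ (Finset.Icc 1 ⌊x⌋₊).filter Nat.Prime, (1 + g p / (p : ℝ)) ≤ P := by
      refine prod_le_prod_of_subset_of_one_le (filter_subset_filter _ (Icc_subset_Icc le_rfl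
        (Nat.floor_le_floor (h.le.trans (le_max_left _ _)))))
        (fun p _ ↦ zero_le_one.trans (hfac p)) fun p _ _ ↦ hfac p
    have h2 : 1 ≤ ∑ n ∈ Finset.Icc 1 ⌊x⌋₊, g n := by
      rw [← hmul.map_one]
      refine single_le_sum (fun n _ ↦ hnonneg n) ?_
      rw [mem_Icc, Nat.le_floor_iff (by linarith)]
      exact ⟨le_rfl, by push_cast; linarith⟩
    refine le_trans ?_ h2
    have hx0 : 0 < x := by linarith
    calc min c₂ (Real.log 2 / (max x₀ 2 * P)) * x / Real.log x *
          ∏ p ∈ (Finset.Icc 1 ⌊x⌋₊).filter Nat.Prime, (1 + g p / (p : ℝ))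
        ≤ Real.log 2 / (max x₀ 2 * P) * max x₀ 2 / Real.log 2 * P := by
          gcongr
          · exact prod_nonneg fun p _ ↦ zero_le_one.trans (hfac p)
          · exact min_le_right _ _
          · exact h.le.trans (le_max_left _ _)
      _ = 1 := by
          have : max x₀ 2 ≠ 0 := by positivity
          field_simp
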